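/- \textbf{The game $G_{\mathrm{IP}}(n,t,\eta_{\mathrm{err}},\eta_{\mathrm{loss}})$.} Let $t\ge 1$. A uniformly random $x\in\{0,1\}^n$ and independent Haar-random unitaries $U,u_1,\dots,u_t,v_1,\dots,v_{t-1}\in U(2)$ are drawn, and $v_t$ is defined by $u_1v_1u_2v_2\cdots u_tv_t=U$. Alice receives the $n$-qubit state $U^{\otimes n}|x\rangle$ and the classical description of $u_1,\dots,u_t$; Bob receives the classical description of $v_1,\dots,v_t$. They win if they output the same string $y\in\{\emptyset,0,1\}^n$, with at most $\eta_{\mathrm{err}}n$ positions where $y_i\notin\{\emptyset,x_i\}$ and at most $\eta_{\mathrm{loss}}n$ positions where $y_i=\emptyset$. \textbf{Attacks.} An attack with $M$ EPR pairs works as follows. Alice and Bob share $M$ EPR pairs in advance. Alice measures her received qubits together with her halves of the pairs by a finite-outcome quantum measurement depending on $(u_i)$, and Bob measures his halves by a finite-outcome quantum measurement depending on $(v_i)$. They then exchange all their classical information and measurement outcomes in one simultaneous round, and each outputs a string computed from this information. The measurements and the output functions depend measurably on the unitaries. \textbf{Theorem.} There is a constant $c$ with $0<c<3$ such that for all integers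 $n\ge 0$, $t\ge1$ and all real $0<\eta_{\mathrm{err}}\le 1$ there is an attack on $G_{\mathrm{IP}}(n,t,\eta_{\mathrm{err}},0)$ which uses at most $$2^{\,8t\,\left(\log_2(2t/\eta_{\mathrm{err}})\right)^{c}}\; n$$ EPR pairs and wins with probability at least $$1-\min\left(\eta_{\mathrm{err}},\ e^{-2n(\eta_{\mathrm{err}}-\eta_{\mathrm{err}}^2)^2}\right).$$ -/

import Mathlib

open MeasureTheory
open scoped Matrix Kronecker ComplexOrder

noncomputable section

namespace InterleavedProduct

/-- The group `U(2)` of single-qubit unitaries, with its Borel σ-algebra. -/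
abbrev U2 : Type := Matrix.unitaryGroup (Fin 2) ℂ

instance : MeasurableSpace U2 := borel U2

instance : BorelSpace U2 := ⟨rfl⟩

instance : CompactSpace U2 := by
  refine isCompact_iff_compactSpace.mp (?_ : IsCompact
    (Matrix.unitaryGroup (Fin 2) ℂ : Set (Matrix (Fin 2) (Fin 2) ℂ)))
  have hK : IsCompact {A : Matrix (Fin 2) (Fin 2) ℂ |
      ∀ i j, A i j ∈ Metric.closedBall (0 : ℂ) 1} := by
    have h : IsCompact (Set.univ.pi fun _ : Fin 2 => Set.univ.pi fun _ : Fin 2 =>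
        Metric.closedBall (0 : ℂ) 1) :=
      isCompact_univ_pi fun _ => isCompact_univ_pi fun _ => isCompact_closedBall (0 : ℂ) 1
    have e : {A : Matrix (Fin 2) (Fin 2) ℂ | ∀ i j, A i j ∈ Metric.closedBall (0 : ℂ) 1} =
        (Set.univ.pi fun _ : Fin 2 => Set.univ.pi fun _ : Fin 2 =>
          Metric.closedBall (0 : ℂ) 1) :=
      Set.ext fun A => ⟨fun hA i _ j _ => hA i j, fun hA i j => hA i trivial j trivial⟩
    rw [e]
    exact h
  refine hK.of_isClosed_subset ?_ ?_
  · have : ((Matrix.unitaryGroup (Fin 2) ℂ : Set (Matrix (Fin 2) (Fin 2) ℂ))) =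
        {A | A * star A = 1} := by
      ext A
      exact Matrix.mem_unitaryGroup_iff
    rw [this]
    exact isClosed_eq (by fun_prop) continuous_const
  · intro A hA i j
    simpa using entry_norm_bound_of_unitary hA i j

/-- The Haar probability measure on `U(2)`. -/
def haarU2 : Measure U2 := Measure.haarMeasure ⊤

/-- Labels of the computational basis of `k` qubits. -/
abbrev Bits (k : ℕ) : Type := Fin k → Fin 2

/-! ### The protocol -/

/-- The `n`-qubit state `U^{⊗n} |x⟩`, by its amplitudes `∏ᵢ ⟨yᵢ| U |xᵢ⟩` in the computational
basis. -/
def challengeState {n : ℕ} (U : U2) (x : Bits n) : Bits n → ℂ :=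
  fun y => ∏ i, (U : Matrix (Fin 2) (Fin 2) ℂ) (y i) (x i)

/-- The independent unitaries drawn by the verifier: the basis `U`, then `u₁, …, u_t`, then
`v₁, …, v_{t-1}`. -/
abbrev Draw (t : ℕ) : Type := U2 × (Fin t → U2) × (Fin (t - 1) → U2)

/-- All the unitaries drawn are independent and Haar distributed. -/
def drawMeasure (t : ℕ) : Measure (Draw t) :=
  haarU2.prod ((Measure.pi fun _ => haarU2).prod (Measure.pi fun _ => haarU2))

/-- The list `v₁, …, v_t`: the first `t - 1` entries are the ones drawn, and
`v_t = (u₁ v₁ ⋯ u_{t-1} v_{t-1} u_t)⁻¹ U`, so that `u₁ v₁ ⋯ u_t v_t = U`. -/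
def fullV {t : ℕ} (d : Draw t) : Fin t → U2 := fun i =>
  if h : (i : ℕ) < t - 1 then d.2.2 ⟨i, h⟩
  else ((List.ofFn fun j : Fin (t - 1) =>
      d.2.1 (Fin.castLE (Nat.sub_le t 1) j) * d.2.2 j).prod * d.2.1 i)⁻¹ * d.1

open Classical in
/-- The number of wrong bits of an answer; `none` is an empty result. -/
def errors {n : ℕ} (x : Bits n) (y : Fin n → Option (Fin 2)) : ℕ :=
  (Finset.univ.filter fun i => y i ≠ none ∧ y i ≠ some (x i)).card

open Classical in
/-- The number of empty results of an answer. -/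
def losses {n : ℕ} (y : Fin n → Option (Fin 2)) : ℕ :=
  (Finset.univ.filter fun i => y i = none).card

/-- The verifiers accept: they receive the same string, with at most `ηerr n` errors and at most
`ηloss n` empty results. -/
def Accepts {n : ℕ} (ηerr ηloss : ℝ) (x : Bits n) (yA yB : Fin n → Option (Fin 2)) : Prop :=
  yA = yB ∧ (errors x yA : ℝ) ≤ ηerr * n ∧ (losses yA : ℝ) ≤ ηloss * n

/-! ### Attacks by two cheaters sharing EPR pairs -/

/-- A quantum measurement (POVM) with `k` outcomes on the space with orthonormal basis `ι`. -/
structure Measurement (k : ℕ) (ι : Type) [Fintype ι] [DecidableEq ι] where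
  effect : Fin k → Matrix ι ι ℂ
  posSemidef : ∀ a, (effect a).PosSemidef
  sum_eq_one : ∑ a, effect a = 1

/-- A strategy of Alice and Bob sharing `M` EPR pairs. Alice measures the challenge qubits
together with her `M` halves, depending on `u₁, …, u_t`; Bob measures his `M` halves, depending on
`v₁, …, v_t`. After one simultaneous exchange of all their classical data, each of them computes an
answer. Everything depends measurably on the unitaries. -/
structure Attack (n t M : ℕ) where
  kA : ℕ
  kB : ℕ
  alice : (Fin t → U2) → Measurement kA (Bits n × Bits M)
  bob : (Fin t → U2) → Measurement kB (Bits M)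
  answerA : (Fin t → U2) → (Fin t → U2) → Fin kA → Fin kB → Fin n → Option (Fin 2)
  answerB : (Fin t → U2) → (Fin t → U2) → Fin kA → Fin kB → Fin n → Option (Fin 2)
  measurable_alice : ∀ a p q, Measurable fun u => (alice u).effect a p q
  measurable_bob : ∀ b p q, Measurable fun v => (bob v).effect b p q
  measurable_answerA : ∀ a b y,
    MeasurableSet {w : (Fin t → U2) × (Fin t → U2) | answerA w.1 w.2 a b = y}
  measurable_answerB : ∀ a b y,
    MeasurableSet {w : (Fin t → U2) × (Fin t → U2) | answerB w.1 w.2 a b = y}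

/-- The joint state `|ψ⟩_C ⊗ |Φ⁺⟩_{AB}^{⊗M}`, where `|Φ⁺⟩ = (|00⟩ + |11⟩)/√2`. -/
def jointState {n : ℕ} (M : ℕ) (ψ : Bits n → ℂ) : (Bits n × Bits M) × Bits M → ℂ :=
  fun p => ψ p.1.1 * ∏ i, if p.1.2 i = p.2 i then ((1 / Real.sqrt 2 : ℝ) : ℂ) else 0

/-- Born's rule: the probability that Alice finds `a` and Bob finds `b`. -/
def outcomeProb {n t M : ℕ} (S : Attack n t M) (ψ : Bits n → ℂ) (u v : Fin t → U2)
    (a : Fin S.kA) (b : Fin S.kB) : ℝ :=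
  (star (jointState M ψ) ⬝ᵥ
    (((S.alice u).effect a ⊗ₖ (S.bob v).effect b) *ᵥ jointState M ψ)).re

open Classical in
/-- The probability that the attack is accepted, given the choices of the verifiers. -/
def winProbGiven {n t M : ℕ} (S : Attack n t M) (ηerr ηloss : ℝ) (x : Bits n) (d : Draw t) : ℝ :=
  ∑ a, ∑ b, if Accepts ηerr ηloss x (S.answerA d.2.1 (fullV d) a b) (S.answerB d.2.1 (fullV d) a b)
    then outcomeProb S (challengeState d.1 x) d.2.1 (fullV d) a b else 0

/-- The probability that the attack wins the game `G_IP(n, t, ηerr, ηloss)`, over uniform `x`, Haar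
distributed unitaries and the outcomes of the measurements. -/
def winProb {n t M : ℕ} (S : Attack n t M) (ηerr ηloss : ℝ) : ℝ :=
  ∫ d, (∑ x : Bits n, winProbGiven S ηerr ηloss x d) / 2 ^ n ∂(drawMeasure t)

end InterleavedProduct

end

/-!
The attack replaces the usual gate-by-gate approximation of the unitaries by nested port-based
teleportation of each challenge qubit. Alice undoes `u₁` on the qubit `u₁ v₁ ⋯ u_t v_t |x⟩` and
teleports it through `N` ports. Port-based teleportation needs no correction, so Bob, not knowing
which port carries the qubit, undoes `v₁` on all ports and teleports each of them back through `N`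
new ports; Alice undoes `u₂` on all of these, and so on. After `2 t - 1` layers Bob undoes `v_t` and
measures in the computational basis. All measurements are made without communication, and the
outcomes, once exchanged, single out the branch that holds the answer. The cost is
`N + N ^ 2 + ⋯ + N ^ (2 t - 1) ≤ N ^ (2 t)` EPR pairs for each qubit.

Teleportation uses an explicit measurement (`portEffect`), polynomial in the sum of the EPR
projectors. Only the traces of this sum and of its square enter the proof that its entanglement
infidelity is at most `3 / N` (`sum_re_trace_portEffect_mul_portProj_ge`). A teleported pure state is
therefore found in the orthogonal state with probability at most `6 / N`
(`re_trace_portPullback_compl_le`), and the square roots of error probabilities add up along the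
layers (`re_trace_portPullback_le`, `Relay.step`), so that `k` layers err with probability at most
`6 k ^ 2 / N`, for all choices of the unitaries.

With `N` about `6 (2 t - 1) ^ 2 / η ^ 2`, which is at most `(2 t / η) ^ 4`, each bit is wrong with
probability at most `η ^ 2`, independently of the others (`Relay.winProbGiven_attack`). The number of
errors exceeds `η n` with probability at most `η` by Markov's inequality (`sum_tail_le`), and at most
`exp (-2 n (η - η ^ 2) ^ 2)` by Hoeffding's (`sum_tail_le_exp`). The number of pairs is at most
`(2 t / η) ^ (8 t) n`, which is the claimed bound with the exponent `c = 1`.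
-/

noncomputable section

namespace InterleavedProduct

/-! ### Measuring one half of a maximally entangled state -/

section Effective

variable {κ H : Type} [Fintype H]

/-- The effect on `κ` obtained from an effect `A` on `κ ⊗ H` and an effect `B` on a second copy of
`H`, when the two copies of `H` are in the maximally entangled state `|H|^{-1/2} ∑ h, |h, h⟩`: for
every input state `ψ` on `κ`, the probability of the pair of outcomes is `⟨ψ| effective A B |ψ⟩`. -/
def effective (A : Matrix (κ × H) (κ × H) ℂ) (B : Matrix H H ℂ) : Matrix κ κ ℂ :=
  fun y y' => (Fintype.card H : ℂ)⁻¹ * ∑ h, ∑ h', A (y, h) (y', h') * B h h'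

theorem effective_posSemidef [Fintype κ] [DecidableEq κ] [DecidableEq H]
    {A : Matrix (κ × H) (κ × H) ℂ} {B : Matrix H H ℂ} (hA : A.PosSemidef) (hB : B.PosSemidef) :
    (effective A B).PosSemidef := by
  have hC := ((hA.kronecker hB).submatrix (fun p : κ × H => (p, p.2))).conjTranspose_mul_mul_same
    ((1 : Matrix κ κ ℂ).submatrix Prod.fst id)
  have hc : (0 : ℂ) ≤ (Fintype.card H : ℂ)⁻¹ := by positivity
  suffices h : effective A B = (Fintype.card H : ℂ)⁻¹ • _ from h ▸ hC.smul hc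
  ext y y'
  simp only [effective, Matrix.smul_apply, smul_eq_mul, Matrix.mul_apply, Fintype.sum_prod_type,
    Matrix.conjTranspose_apply, Matrix.submatrix_apply, Matrix.one_apply, id,
    Matrix.kroneckerMap_apply]
  congr 1
  simp only [mul_ite, mul_one, mul_zero, Finset.sum_ite_irrel, Finset.sum_const_zero,
    Finset.sum_ite_eq', Finset.mem_univ, if_true, apply_ite star, star_one, star_zero, ite_mul,
    one_mul, zero_mul]
  exact Finset.sum_comm

theorem effective_sum_left {O : Type} (s : Finset O) (A : O → Matrix (κ × H) (κ × H) ℂ)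
    (B : Matrix H H ℂ) : effective (∑ a ∈ s, A a) B = ∑ a ∈ s, effective (A a) B := by
  ext y y'
  simp only [effective, Matrix.sum_apply, Finset.sum_mul, ← Finset.mul_sum]
  congr 1
  rw [Finset.sum_comm]
  simp_rw [Finset.sum_comm (s := s)]
  exact Finset.sum_comm

theorem effective_sum_right {O : Type} (s : Finset O) (A : Matrix (κ × H) (κ × H) ℂ)
    (B : O → Matrix H H ℂ) : effective A (∑ b ∈ s, B b) = ∑ b ∈ s, effective A (B b) := by
  ext y y'
  simp only [effective, Matrix.sum_apply, Finset.mul_sum]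
  simp_rw [Finset.sum_comm (s := s)]

theorem effective_smul_right (A : Matrix (κ × H) (κ × H) ℂ) (c : ℂ) (B : Matrix H H ℂ) :
    effective A (c • B) = c • effective A B := by
  ext y y'
  simp only [effective, Matrix.smul_apply, smul_eq_mul, Finset.mul_sum]
  refine Finset.sum_congr rfl fun h _ => Finset.sum_congr rfl fun h' _ => by ring

theorem effective_add_right (A : Matrix (κ × H) (κ × H) ℂ) (B C : Matrix H H ℂ) :
    effective A (B + C) = effective A B + effective A C := by
  ext y y'
  simp only [effective, Matrix.add_apply, mul_add, Finset.sum_add_distrib]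

theorem effective_one [DecidableEq κ] [DecidableEq H] [Nonempty H] :
    effective (1 : Matrix (κ × H) (κ × H) ℂ) (1 : Matrix H H ℂ) = 1 := by
  ext y y'
  have : (Fintype.card H : ℂ) ≠ 0 := by simp
  by_cases h : y = y' <;> simp [effective, Matrix.one_apply, h, this]

theorem effective_kronecker_one_conj [Fintype κ] [DecidableEq H] (w : Matrix κ κ ℂ)
    (A : Matrix (κ × H) (κ × H) ℂ) (B : Matrix H H ℂ) :
    effective ((w ⊗ₖ (1 : Matrix H H ℂ)) * A * (w ⊗ₖ (1 : Matrix H H ℂ))ᴴ) B =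
      w * effective A B * wᴴ := by
  ext y y'
  simp only [effective, Matrix.mul_apply, Fintype.sum_prod_type,
    Matrix.conjTranspose_apply, Matrix.one_apply, Matrix.kroneckerMap_apply, mul_ite, mul_one,
    mul_zero, ite_mul, zero_mul, apply_ite star, star_zero, Finset.sum_ite_eq, Finset.mem_univ,
    if_true, Finset.sum_mul, Finset.mul_sum]
  simp_rw [Finset.sum_comm (s := (Finset.univ : Finset H)) (t := (Finset.univ : Finset κ))]
  refine Finset.sum_congr rfl fun a _ => Finset.sum_congr rfl fun b _ =>
    Finset.sum_congr rfl fun c _ => Finset.sum_congr rfl fun d _ => by ring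

end Effective

/-! ### Tensor powers -/

section PiTensor

variable {ι κ : Type} [Fintype ι]

/-- The tensor product `⨂ i, A i` of a finite family of square matrices, on the basis `ι → κ`. -/
def piTensor (A : ι → Matrix κ κ ℂ) : Matrix (ι → κ) (ι → κ) ℂ :=
  fun p q => ∏ i, A i (p i) (q i)

theorem piTensor_mul [DecidableEq ι] [Fintype κ] (A B : ι → Matrix κ κ ℂ) :
    piTensor A * piTensor B = piTensor fun i => A i * B i := by
  ext p q
  simp only [piTensor, Matrix.mul_apply, Finset.prod_univ_sum, Fintype.piFinset_univ,
    Finset.prod_mul_distrib]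

theorem piTensor_conjTranspose (A : ι → Matrix κ κ ℂ) :
    (piTensor A)ᴴ = piTensor fun i => (A i)ᴴ := by
  ext p q
  simp [piTensor, Matrix.conjTranspose_apply, star_prod]

theorem piTensor_one [DecidableEq κ] : piTensor (fun _ : ι => (1 : Matrix κ κ ℂ)) = 1 := by
  ext p q
  simp only [piTensor, Matrix.one_apply, Finset.prod_ite_zero, Finset.mem_univ, true_implies,
    Finset.prod_const_one, funext_iff]

open scoped MatrixOrder Matrix.Norms.L2Operator in
/-- The tensor product of the square roots of the factors is a square root of the tensor product. -/
theorem piTensor_posSemidef [DecidableEq ι] [Fintype κ] [DecidableEq κ] {A : ι → Matrix κ κ ℂ}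
    (hA : ∀ i, (A i).PosSemidef) :
    (piTensor A).PosSemidef := by
  choose B hB using fun i => CStarAlgebra.nonneg_iff_eq_star_mul_self.mp (hA i).nonneg
  have : piTensor A = (piTensor B)ᴴ * piTensor B := by
    rw [piTensor_conjTranspose, piTensor_mul]
    exact congrArg piTensor (funext hB)
  rw [this]
  exact Matrix.posSemidef_conjTranspose_mul_self _

theorem sum_piTensor [DecidableEq ι] {O : Type} [Fintype O] (A : ι → O → Matrix κ κ ℂ) :
    ∑ d : ι → O, piTensor (fun i => A i (d i)) = piTensor fun i => ∑ o, A i o := by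
  ext p q
  simp only [piTensor, Matrix.sum_apply, Finset.prod_univ_sum, Fintype.piFinset_univ]

end PiTensor

/-! ### Operators on the teleported qubit and one port -/

theorem trace_mul_effective {κ H : Type} [Fintype κ] [Fintype H] (P : Matrix κ κ ℂ)
    (A : Matrix (κ × H) (κ × H) ℂ) (B : Matrix H H ℂ) :
    (P * effective A B).trace = (Fintype.card H : ℂ)⁻¹ * (A * (P ⊗ₖ Bᵀ)).trace := by
  simp only [Matrix.trace, Matrix.diag_apply, Matrix.mul_apply, effective, Fintype.sum_prod_type,
    Matrix.kroneckerMap_apply, Matrix.transpose_apply, Finset.mul_sum]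
  rw [Finset.sum_comm]
  refine Finset.sum_congr rfl fun y _ => ?_
  rw [Finset.sum_comm]
  refine Finset.sum_congr rfl fun h _ => Finset.sum_congr rfl fun y' _ =>
    Finset.sum_congr rfl fun h' _ => by ring

section Port

variable {N : ℕ}

/-- Splits the basis of the teleported qubit and the `N` ports into the pair (teleported qubit,
port `i`) and the other ports. -/
def portEquiv (i : Fin N) : Fin 2 × Bits N ≃ (Fin 2 × Fin 2) × ({j // j ≠ i} → Fin 2) :=
  ((Equiv.refl (Fin 2)).prodCongr (Equiv.funSplitAt i (Fin 2))).trans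
    (Equiv.prodAssoc _ _ _).symm

/-- The operator `A` acting on the teleported qubit and port `i`, tensored with the identity on the
other ports. -/
def onPort (i : Fin N) (A : Matrix (Fin 2 × Fin 2) (Fin 2 × Fin 2) ℂ) :
    Matrix (Fin 2 × Bits N) (Fin 2 × Bits N) ℂ :=
  (A ⊗ₖ (1 : Matrix ({j // j ≠ i} → Fin 2) ({j // j ≠ i} → Fin 2) ℂ)).submatrix
    (portEquiv i) (portEquiv i)

theorem onPort_apply (i : Fin N) (A : Matrix (Fin 2 × Fin 2) (Fin 2 × Fin 2) ℂ)
    (p q : Fin 2 × Bits N) :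
    onPort i A p q = if ∀ j, j ≠ i → p.2 j = q.2 j then A (p.1, p.2 i) (q.1, q.2 i) else 0 := by
  simp [onPort, portEquiv, Matrix.one_apply, Equiv.funSplitAt, Equiv.piSplitAt, funext_iff]

theorem onPort_mul (i : Fin N) (A B : Matrix (Fin 2 × Fin 2) (Fin 2 × Fin 2) ℂ) :
    onPort i A * onPort i B = onPort i (A * B) := by
  rw [onPort, onPort, Matrix.submatrix_mul_equiv, ← Matrix.mul_kronecker_mul, one_mul, onPort]

theorem onPort_conjTranspose (i : Fin N) (A : Matrix (Fin 2 × Fin 2) (Fin 2 × Fin 2) ℂ) :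
    (onPort i A)ᴴ = onPort i Aᴴ := by
  rw [onPort, Matrix.conjTranspose_submatrix, Matrix.conjTranspose_kronecker,
    Matrix.conjTranspose_one, onPort]

/-- The operator `B` acting on port `i` alone. -/
def tensorAt (i : Fin N) (B : Matrix (Fin 2) (Fin 2) ℂ) : Matrix (Bits N) (Bits N) ℂ :=
  piTensor fun j => if j = i then B else 1

theorem tensorAt_apply (i : Fin N) (B : Matrix (Fin 2) (Fin 2) ℂ) (z z' : Bits N) :
    tensorAt i B z z' = if ∀ j, j ≠ i → z j = z' j then B (z i) (z' i) else 0 := by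
  rw [tensorAt, piTensor, ← Finset.mul_prod_erase _ _ (Finset.mem_univ i), if_pos rfl,
    Finset.prod_congr rfl fun j hj => by rw [if_neg (Finset.ne_of_mem_erase hj)]]
  simp only [Matrix.one_apply, Finset.prod_ite_zero, Finset.prod_const_one, Finset.mem_erase,
    Finset.mem_univ, and_true, mul_ite, mul_one, mul_zero]

theorem tensorAt_posSemidef (i : Fin N) {B : Matrix (Fin 2) (Fin 2) ℂ} (hB : B.PosSemidef) :
    (tensorAt i B).PosSemidef :=
  piTensor_posSemidef fun j => by split_ifs <;> [exact hB; exact Matrix.PosSemidef.one]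

theorem tensorAt_one (i : Fin N) : tensorAt i 1 = 1 := by
  simp [tensorAt, piTensor_one]

theorem tensorAt_add (i : Fin N) (B C : Matrix (Fin 2) (Fin 2) ℂ) :
    tensorAt i (B + C) = tensorAt i B + tensorAt i C := by
  ext z z'
  simp only [tensorAt_apply, Matrix.add_apply]
  split_ifs <;> simp

theorem tensorAt_smul (i : Fin N) (c : ℂ) (B : Matrix (Fin 2) (Fin 2) ℂ) :
    tensorAt i (c • B) = c • tensorAt i B := by
  ext z z'
  simp [tensorAt_apply]

theorem kronecker_tensorAt_transpose (i : Fin N) (P B : Matrix (Fin 2) (Fin 2) ℂ) :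
    P ⊗ₖ (tensorAt i B)ᵀ = onPort i (P ⊗ₖ Bᵀ) := by
  ext p q
  simp only [Matrix.kroneckerMap_apply, Matrix.transpose_apply, tensorAt_apply, onPort_apply,
    mul_ite, mul_zero, eq_comm]

/-- The projector onto the EPR state `(|00⟩ + |11⟩)/√2` of two qubits. -/
def eprProj : Matrix (Fin 2 × Fin 2) (Fin 2 × Fin 2) ℂ :=
  fun p q => if p.1 = p.2 ∧ q.1 = q.2 then 1 / 2 else 0

theorem eprProj_mul_self : eprProj * eprProj = eprProj := by
  ext p q
  by_cases hp : p.1 = p.2 <;> by_cases hq : q.1 = q.2 <;>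
    simp [eprProj, Matrix.mul_apply, Fintype.sum_prod_type, hp, hq]

theorem eprProj_conjTranspose : eprProjᴴ = eprProj := by
  ext p q
  simp only [eprProj, Matrix.conjTranspose_apply, and_comm]
  split_ifs <;> simp

/-- If `P` and `Q` project onto orthogonal states `φ` and `χ`, then `φ ⊗ conj χ` is orthogonal to the
EPR state. -/
theorem kronecker_transpose_mul_eprProj {P Q : Matrix (Fin 2) (Fin 2) ℂ} (h : P * Q = 0) :
    (P ⊗ₖ Qᵀ) * eprProj = 0 := by
  ext p q
  have h' := congrFun₂ h p.1 p.2
  simp only [Matrix.mul_apply, Matrix.zero_apply, Fin.sum_univ_two] at h'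
  by_cases hq : q.1 = q.2
  · simp [eprProj, Matrix.mul_apply, Fintype.sum_prod_type, hq, ← add_mul, h']
  · simp [eprProj, Matrix.mul_apply, hq]

/-- The projector onto the EPR state of the teleported qubit and port `i`. -/
def portProj (i : Fin N) : Matrix (Fin 2 × Bits N) (Fin 2 × Bits N) ℂ := onPort i eprProj

theorem portProj_mul_self (i : Fin N) : portProj i * portProj i = portProj i := by
  rw [portProj, onPort_mul, eprProj_mul_self]

theorem portProj_isHermitian (i : Fin N) : (portProj i).IsHermitian := by
  rw [Matrix.IsHermitian, portProj, onPort_conjTranspose, eprProj_conjTranspose]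

theorem posSemidef_of_isHermitian_of_mul_self {κ : Type} [Fintype κ] {A : Matrix κ κ ℂ}
    (hA : A.IsHermitian) (h : A * A = A) : A.PosSemidef := by
  have := Matrix.posSemidef_conjTranspose_mul_self A
  rwa [hA.eq, h] at this

theorem posSemidef_one_sub_portProj (i : Fin N) : (1 - portProj i).PosSemidef :=
  posSemidef_of_isHermitian_of_mul_self (Matrix.isHermitian_one.sub (portProj_isHermitian i))
    (by rw [sub_mul, mul_sub, mul_sub, portProj_mul_self]; simp)

theorem trace_portProj (i : Fin N) : (portProj i).trace = 2 ^ N / 2 := by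
  simp [Matrix.trace, portProj, onPort_apply, eprProj, Fintype.sum_prod_type_right]
  ring

/-- Flipping the bit `i` matches the strings with `z i = z j` and those with `z i ≠ z j`. -/
theorem card_filter_apply_eq_apply {i j : Fin N} (h : i ≠ j) :
    2 * (Finset.univ.filter fun z : Bits N => z i = z j).card = 2 ^ N := by
  have hne : (Finset.univ.filter fun z : Bits N => z i = z j).card =
      (Finset.univ.filter fun z : Bits N => ¬ z i = z j).card := by
    refine Finset.card_equiv
      (Equiv.piCongrRight fun k => if k = i then Equiv.swap 0 1 else Equiv.refl (Fin 2)) fun z => ?_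
    have key : ∀ a b : Fin 2, a = b ↔ ¬ Equiv.swap 0 1 a = b := by decide
    simpa [h.symm] using key (z i) (z j)
  have := Finset.card_filter_add_card_filter_not (s := (Finset.univ : Finset (Bits N)))
    (fun z : Bits N => z i = z j)
  rw [← hne] at this
  simpa [two_mul] using this

/-- The overlap of two different EPR projectors: a diagonal entry of the product vanishes unless the
strings agree off port `i` and off port `j`, hence everywhere. -/
theorem trace_portProj_mul_portProj {i j : Fin N} (h : i ≠ j) :
    (portProj i * portProj j).trace = 2 ^ N / 8 := by
  have hij : ∀ y y' (z z' : Bits N), portProj i (y, z) (y', z') * portProj j (y', z') (y, z) =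
      if z = z' then if y = z i then if y' = z i then if z i = z j then (1 / 4 : ℂ) else 0
        else 0 else 0 else 0 := by
    intro y y' z z'
    by_cases hz : z = z'
    · subst hz
      simp only [portProj, onPort_apply, eprProj]
      split_ifs <;> simp_all
      norm_num
    · rw [if_neg hz]
      by_contra hne
      obtain ⟨h1, h2⟩ := mul_ne_zero_iff.mp hne
      simp only [portProj, onPort_apply, ne_eq, ite_eq_right_iff, Classical.not_imp] at h1 h2
      refine hz (funext fun k => ?_)
      by_cases hk : k = i
      · exact (h2.1 k fun hkj => h (hk.symm.trans hkj)).symm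
      · exact h1.1 k hk
  have hc : (2 : ℂ) * (Finset.univ.filter fun z : Bits N => z i = z j).card = 2 ^ N := by
    exact_mod_cast card_filter_apply_eq_apply h
  simp only [Matrix.trace, Matrix.diag_apply, Matrix.mul_apply, Fintype.sum_prod_type, hij]
  rw [Finset.sum_comm]
  simp only [Finset.sum_ite_eq, Finset.sum_ite_eq', Finset.mem_univ, if_true,
    Finset.sum_ite_irrel, Finset.sum_const_zero, ← Finset.sum_filter, Finset.sum_const,
    nsmul_eq_mul]
  linear_combination hc / 8

end Port

/-! ### Port-based teleportation -/

section Teleport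

variable (N : ℕ)

/-- The sum of the projectors `portProj i`, rescaled by `4 / N`. Since `portSum` has normalized trace
`1` and normalized second moment `1 + 3 / N`, it is close to the identity. -/
def portSum : Matrix (Fin 2 × Bits N) (Fin 2 × Bits N) ℂ := (4 / N : ℂ) • ∑ i, portProj i

variable {N}

theorem portSum_isHermitian : (portSum N).IsHermitian := by
  have h : (∑ i : Fin N, portProj i).IsHermitian := by
    rw [Matrix.IsHermitian, Matrix.conjTranspose_sum]
    exact Finset.sum_congr rfl fun i _ => (portProj_isHermitian i).eq
  rw [Matrix.IsHermitian, portSum, Matrix.conjTranspose_smul, h.eq]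
  simp

theorem isHermitian_ofNat_sub_portSum (k : ℕ) [k.AtLeastTwo] :
    ((OfNat.ofNat k : Matrix (Fin 2 × Bits N) (Fin 2 × Bits N) ℂ) - portSum N).IsHermitian :=
  (Matrix.isHermitian_natCast k).sub portSum_isHermitian

variable [NeZero N]

/-- The measurement of port-based teleportation. The pretty good measurement would have the effects
`X^{-1/2} (4 / N) portProj i X^{-1/2}` for `X = portSum N`; here `X^{-1/2}` is replaced by its tangent
`(3 - X) / 2` at `X = 1`. As `X ≤ 4`, the defect `1 - (3 - X) X (3 - X) / 4`, which equals
`(1 - X) (4 - X) (1 - X) / 4`, is positive semidefinite; it is added to the effect of port `0`. -/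
def portEffect (i : Fin N) : Matrix (Fin 2 × Bits N) (Fin 2 × Bits N) ℂ :=
  (1 / N : ℂ) • ((3 - portSum N) * portProj i * (3 - portSum N)) +
    if i = 0 then (1 / 4 : ℂ) • ((1 - portSum N) * (4 - portSum N) * (1 - portSum N)) else 0

theorem sum_portProj : ∑ i : Fin N, portProj i = (N / 4 : ℂ) • portSum N := by
  have : (N : ℂ) ≠ 0 := NeZero.ne _
  rw [portSum, smul_smul]
  field_simp
  simp

theorem posSemidef_four_sub_portSum : (4 - portSum N).PosSemidef := by
  have h := (Matrix.posSemidef_sum Finset.univ fun (i : Fin N) _ =>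
    posSemidef_one_sub_portProj i).smul (show (0 : ℂ) ≤ 4 / N by positivity)
  have hN : (N : ℂ) ≠ 0 := NeZero.ne _
  convert h using 1
  rw [Finset.sum_sub_distrib, smul_sub, ← portSum]
  congr 1
  rw [Finset.sum_const, Finset.card_univ, Fintype.card_fin, ← Nat.cast_smul_eq_nsmul ℂ, smul_smul,
    div_mul_cancel₀ _ hN, ← Algebra.algebraMap_eq_smul_one, map_ofNat]

theorem posSemidef_conj_of_isHermitian {κ : Type} [Fintype κ] {A B : Matrix κ κ ℂ}
    (hB : B.IsHermitian) (hA : A.PosSemidef) : (B * A * B).PosSemidef := by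
  have := hA.conjTranspose_mul_mul_same B
  rwa [hB.eq] at this

theorem posSemidef_remainder :
    ((1 / 4 : ℂ) • ((1 - portSum N) * (4 - portSum N) * (1 - portSum N))).PosSemidef :=
  (posSemidef_conj_of_isHermitian (Matrix.isHermitian_one.sub portSum_isHermitian)
    posSemidef_four_sub_portSum).smul (by positivity)

theorem posSemidef_portEffect (i : Fin N) : (portEffect i).PosSemidef := by
  refine Matrix.PosSemidef.add ((posSemidef_conj_of_isHermitian (isHermitian_ofNat_sub_portSum 3)
    (posSemidef_of_isHermitian_of_mul_self (portProj_isHermitian i)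
      (portProj_mul_self i))).smul (by positivity)) ?_
  split_ifs
  · exact posSemidef_remainder
  · exact Matrix.PosSemidef.zero

theorem sum_portEffect : ∑ i : Fin N, portEffect i = 1 := by
  have hN : (N : ℂ) ≠ 0 := NeZero.ne _
  simp only [portEffect, Finset.sum_add_distrib, Finset.sum_ite_eq', Finset.mem_univ, if_true,
    ← Finset.smul_sum, ← Finset.sum_mul, ← Finset.mul_sum]
  rw [sum_portProj, mul_smul_comm, smul_mul_assoc, smul_smul,
    show (1 / N * (N / 4) : ℂ) = 1 / 4 by field_simp, ← smul_add]
  have : (3 - portSum N) * portSum N * (3 - portSum N) +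
      (1 - portSum N) * (4 - portSum N) * (1 - portSum N) = (4 : ℂ) • 1 := by
    rw [← Algebra.algebraMap_eq_smul_one, map_ofNat]
    noncomm_ring
    norm_num
  rw [this, smul_smul]
  norm_num

theorem trace_portSum : (portSum N).trace = 2 * 2 ^ N := by
  have hN : (N : ℂ) ≠ 0 := NeZero.ne _
  simp only [portSum, Matrix.trace_smul, Matrix.trace_sum, trace_portProj, Finset.sum_const,
    Finset.card_univ, Fintype.card_fin, nsmul_eq_mul, smul_eq_mul]
  field_simp
  norm_num

theorem trace_portSum_mul_portSum : (portSum N * portSum N).trace = 2 * 2 ^ N * (1 + 3 / N) := by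
  have hN : (N : ℂ) ≠ 0 := NeZero.ne _
  have h : ∀ i j : Fin N, (portProj i * portProj j).trace =
      (if i = j then 3 * 2 ^ N / 8 else 0) + 2 ^ N / 8 := by
    intro i j
    by_cases hij : i = j
    · rw [← hij, portProj_mul_self, trace_portProj, if_pos rfl]
      ring
    · rw [trace_portProj_mul_portProj hij, if_neg hij, zero_add]
  simp only [portSum, Matrix.smul_mul, Matrix.mul_smul, Matrix.trace_smul, Finset.sum_mul,
    Finset.mul_sum, Matrix.trace_sum, h, Finset.sum_add_distrib, Finset.sum_ite_eq',
    Finset.mem_univ, if_true, Finset.sum_const,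
    Finset.card_univ, Fintype.card_fin, nsmul_eq_mul, smul_eq_mul]
  field_simp
  ring

/-- A linear lower bound for `tr (F A F A)`, from `0 ≤ tr (A F A - 2 A)²`. It is tight at `F = 2`,
the value of `3 - portSum N` where `portSum N` is the identity. -/
theorem re_trace_sandwich_ge {κ : Type} [Fintype κ] {F A : Matrix κ κ ℂ}
    (hF : F.IsHermitian) (hA : A.IsHermitian) (hA2 : A * A = A) :
    4 * (A * F).trace.re - 4 * A.trace.re ≤ (F * A * F * A).trace.re := by
  have hG : (A * F * A - (2 : ℂ) • A).IsHermitian := by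
    simp only [Matrix.IsHermitian, Matrix.conjTranspose_sub, Matrix.conjTranspose_mul, hA.eq,
      hF.eq, Matrix.conjTranspose_smul, Matrix.mul_assoc]
    simp
  have hpos := (Matrix.posSemidef_conjTranspose_mul_self (A * F * A - (2 : ℂ) • A)).trace_nonneg
  have e : (A * F * A - (2 : ℂ) • A) * (A * F * A - (2 : ℂ) • A) =
      A * (F * A * F * A) - (4 : ℂ) • (A * F * A) + (4 : ℂ) • A := by
    have h1 : A * F * A * (A * F * A) = A * (F * A * F * A) := by
      calc A * F * A * (A * F * A) = A * F * (A * A) * F * A := by noncomm_ring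
        _ = _ := by rw [hA2]; noncomm_ring
    have h2 : A * F * A * A = A * F * A := by rw [mul_assoc, hA2]
    have h3 : A * (A * F * A) = A * F * A := by
      rw [← mul_assoc, ← mul_assoc, hA2]
    rw [sub_mul, mul_sub, mul_sub, h1, smul_mul_assoc, mul_smul_comm, smul_mul_assoc,
      mul_smul_comm, h2, h3, hA2]
    module
  have t1 : (A * (F * A * F * A)).trace = (F * A * F * A).trace := by
    rw [Matrix.trace_mul_comm, Matrix.mul_assoc (F * A * F), hA2]
  have t2 : (A * F * A).trace = (A * F).trace := by
    rw [Matrix.trace_mul_comm, ← Matrix.mul_assoc, hA2]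
  rw [hG.eq, e, Matrix.trace_add, Matrix.trace_sub, Matrix.trace_smul, Matrix.trace_smul, t1,
    t2] at hpos
  have := (Complex.le_def.mp hpos).1
  simp at this
  linarith

theorem re_trace_mul_nonneg {κ : Type} [Fintype κ] {A B : Matrix κ κ ℂ} (hA : A.PosSemidef)
    (hB : B.IsHermitian) (hB2 : B * B = B) : 0 ≤ (A * B).trace.re := by
  have h := (posSemidef_conj_of_isHermitian hB hA).trace_nonneg
  rw [Matrix.mul_assoc, Matrix.trace_mul_comm, Matrix.mul_assoc, hB2] at h
  exact (Complex.le_def.mp h).1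

/-- The entanglement fidelity of port-based teleportation with `N` ports, here multiplied by
`2 * 2 ^ N`, is at least `1 - 3 / N`. -/
theorem sum_re_trace_portEffect_mul_portProj_ge :
    2 * 2 ^ N * (1 - 3 / N : ℝ) ≤ ∑ i : Fin N, (portEffect i * portProj i).trace.re := by
  have hN : (0 : ℝ) < N := Nat.cast_pos.mpr (NeZero.pos N)
  have key : ∀ i : Fin N, (1 / N : ℝ) * (4 * (portProj i * (3 - portSum N)).trace.re
      - 4 * (portProj i).trace.re) ≤ (portEffect i * portProj i).trace.re := by
    intro i
    have h1 := re_trace_sandwich_ge (isHermitian_ofNat_sub_portSum (N := N) 3)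
      (portProj_isHermitian i) (portProj_mul_self i)
    have h2 : 0 ≤ ((if i = 0 then (1 / 4 : ℂ) • ((1 - portSum N) * (4 - portSum N) *
        (1 - portSum N)) else 0) * portProj i).trace.re := by
      refine re_trace_mul_nonneg ?_ (portProj_isHermitian i) (portProj_mul_self i)
      split_ifs
      · exact posSemidef_remainder
      · exact Matrix.PosSemidef.zero
    rw [portEffect, add_mul, Matrix.trace_add, Complex.add_re, smul_mul_assoc, Matrix.trace_smul,
      smul_eq_mul, show (1 / N : ℂ) = ((1 / N : ℝ) : ℂ) by push_cast; rfl, Complex.re_ofReal_mul]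
    have := mul_le_mul_of_nonneg_left h1 (show 0 ≤ (1 / N : ℝ) by positivity)
    linarith
  have h3 : (portSum N * 3).trace = 3 * (portSum N).trace := by
    have : portSum N * 3 = (3 : ℂ) • portSum N := by
      rw [Algebra.smul_def, map_ofNat, (Commute.ofNat_left 3 (portSum N)).eq]
    rw [this, Matrix.trace_smul, smul_eq_mul]
  refine le_trans ?_ (Finset.sum_le_sum fun i _ => key i)
  rw [← Finset.mul_sum, Finset.sum_sub_distrib, ← Finset.mul_sum, ← Finset.mul_sum,
    ← Complex.re_sum, ← Complex.re_sum, ← Matrix.trace_sum, ← Matrix.trace_sum, ← Finset.sum_mul,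
    sum_portProj, smul_mul_assoc, Matrix.trace_smul, Matrix.trace_smul, mul_sub (portSum N),
    Matrix.trace_sub, trace_portSum_mul_portSum, trace_portSum,
    h3, trace_portSum]
  have e1 : ((N / 4 : ℂ) • (3 * (2 * 2 ^ N) - 2 * 2 ^ N * (1 + 3 / N)) : ℂ).re =
      (N / 4 : ℝ) * (3 * (2 * 2 ^ N) - 2 * 2 ^ N * (1 + 3 / N)) := by
    rw [← Complex.ofReal_re ((N / 4 : ℝ) * (3 * (2 * 2 ^ N) - 2 * 2 ^ N * (1 + 3 / N)))]
    push_cast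
    simp
  have e2 : ((N / 4 : ℂ) • (2 * 2 ^ N) : ℂ).re = (N / 4 : ℝ) * (2 * 2 ^ N) := by
    rw [← Complex.ofReal_re ((N / 4 : ℝ) * (2 * 2 ^ N))]
    push_cast
    simp
  rw [e1, e2]
  apply le_of_eq
  field_simp
  ring

end Teleport

/-! ### The teleportation channel in the Heisenberg picture -/

section Pullback

variable (N : ℕ) [NeZero N]

/-- Port-based teleportation in the Heisenberg picture: the effect on the input qubit that results
from measuring the effect `T` on the port announced by the teleportation. -/
def portPullback (T : Matrix (Fin 2) (Fin 2) ℂ) : Matrix (Fin 2) (Fin 2) ℂ :=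
  ∑ i : Fin N, effective (portEffect i) (tensorAt i T)

theorem portPullback_posSemidef {T : Matrix (Fin 2) (Fin 2) ℂ} (hT : T.PosSemidef) :
    (portPullback N T).PosSemidef :=
  Matrix.posSemidef_sum _ fun i _ =>
    effective_posSemidef (posSemidef_portEffect i) (tensorAt_posSemidef i hT)

theorem portPullback_one : portPullback N 1 = 1 := by
  simp only [portPullback, tensorAt_one, ← effective_sum_left, sum_portEffect, effective_one]

theorem portPullback_add (S T : Matrix (Fin 2) (Fin 2) ℂ) :
    portPullback N (S + T) = portPullback N S + portPullback N T := by
  simp only [portPullback, tensorAt_add, effective_add_right, Finset.sum_add_distrib]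

theorem portPullback_smul (c : ℂ) (T : Matrix (Fin 2) (Fin 2) ℂ) :
    portPullback N (c • T) = c • portPullback N T := by
  simp only [portPullback, tensorAt_smul, effective_smul_right, Finset.smul_sum]

variable {P : Matrix (Fin 2) (Fin 2) ℂ}

/-- A pure state `P` teleported through `N` ports is found in the orthogonal state with probability at
most `6 / N`: the event `P ⊗ (1 - P)ᵀ` on (input, port) is orthogonal to the EPR projector, so it is
bounded by the loss of entanglement fidelity. -/
theorem re_trace_portPullback_compl_le (hP : P.IsHermitian) (hP2 : P * P = P) :
    (P * portPullback N (1 - P)).trace.re ≤ 6 / N := by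
  have hN : (0 : ℝ) < N := Nat.cast_pos.mpr (NeZero.pos N)
  set K : Fin N → Matrix (Fin 2 × Bits N) (Fin 2 × Bits N) ℂ :=
    fun i => onPort i (P ⊗ₖ (1 - P)ᵀ) with hK
  have hQ2 : (1 - P) * (1 - P) = 1 - P := by rw [sub_mul, mul_sub, mul_sub, hP2]; simp
  have hKh : ∀ i, (K i)ᴴ = K i := fun i => by
    rw [hK, onPort_conjTranspose, Matrix.conjTranspose_kronecker, hP.eq,
      ((Matrix.isHermitian_one.sub hP).transpose).eq]
  have hK2 : ∀ i, K i * K i = K i := fun i => by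
    rw [hK, onPort_mul, ← Matrix.mul_kronecker_mul, hP2, ← Matrix.transpose_mul, hQ2]
  have hKP : ∀ i, K i * portProj i = 0 := fun i => by
    rw [hK, portProj, onPort_mul, kronecker_transpose_mul_eprProj (by rw [mul_sub, hP2]; simp)]
    simp [onPort]
  have hPK : ∀ i, portProj i * K i = 0 := fun i => by
    have := congrArg Matrix.conjTranspose (hKP i)
    rwa [Matrix.conjTranspose_mul, hKh, (portProj_isHermitian i).eq,
      Matrix.conjTranspose_zero] at this
  have hle : ∀ i, (portEffect i * K i).trace.re ≤
      (portEffect i).trace.re - (portEffect i * portProj i).trace.re := by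
    intro i
    have := re_trace_mul_nonneg (posSemidef_portEffect i) (B := 1 - portProj i - K i)
      ((Matrix.isHermitian_one.sub (portProj_isHermitian i)).sub (hKh i))
      (by simp only [sub_mul, mul_sub, hK2, hKP, hPK, portProj_mul_self, mul_one, one_mul]
          abel)
    simp only [mul_sub, mul_one, Matrix.trace_sub, Complex.sub_re] at this
    linarith
  have htr : ∑ i : Fin N, (portEffect i).trace.re = 2 * 2 ^ N := by
    rw [← Complex.re_sum, ← Matrix.trace_sum, sum_portEffect, Matrix.trace_one]
    simp [show ((2 : ℂ) ^ N).re = 2 ^ N by exact_mod_cast Complex.ofReal_re (2 ^ N)]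
  have hsum : (P * portPullback N (1 - P)).trace.re =
      (2 ^ N : ℝ)⁻¹ * ∑ i : Fin N, (portEffect i * K i).trace.re := by
    simp only [portPullback, Finset.mul_sum, Matrix.trace_sum, trace_mul_effective,
      kronecker_tensorAt_transpose, Complex.re_sum]
    refine Finset.sum_congr rfl fun i _ => ?_
    rw [← Complex.re_ofReal_mul]
    simp [hK]
  have h1 := sum_re_trace_portEffect_mul_portProj_ge (N := N)
  have h2 := Finset.sum_le_sum fun i (_ : i ∈ Finset.univ) => hle i
  rw [Finset.sum_sub_distrib, htr] at h2
  rw [hsum, inv_mul_le_iff₀ (by positivity)]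
  calc _ ≤ 2 * 2 ^ N - 2 * 2 ^ N * (1 - 3 / N : ℝ) := by linarith
    _ = 2 ^ N * (6 / N) := by field_simp; ring

/-- How an error probability `δ` of the effect `T` grows when the input is first teleported. The
coherence between `P` and `1 - P` is controlled by
`T ≤ (1 + s) P T P + (1 + s⁻¹) (1 - P) T (1 - P)`, for any `s > 0`. -/
theorem re_trace_portPullback_le (hP : P.IsHermitian) (hP2 : P * P = P) (hP1 : P.trace = 1)
    {T : Matrix (Fin 2) (Fin 2) ℂ} (hT : T.PosSemidef) (hT1 : (1 - T).PosSemidef) {δ : ℝ}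
    (hδ : 0 ≤ δ)
    (hPT : ((δ : ℂ) • P - P * T * P).PosSemidef) {s : ℝ} (hs : 0 < s) :
    (P * portPullback N T).trace.re ≤ (1 + s) * δ + (1 + s⁻¹) * (6 / N) := by
  have hQh : (1 - P).IsHermitian := Matrix.isHermitian_one.sub hP
  have hQ2 : (1 - P) * (1 - P) = 1 - P := by rw [sub_mul, mul_sub, mul_sub, hP2]; simp
  have hsC : (s : ℂ) ≠ 0 := by exact_mod_cast hs.ne'
  have nonneg : ∀ {A : Matrix (Fin 2) (Fin 2) ℂ}, A.PosSemidef →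
      0 ≤ (P * portPullback N A).trace.re := fun hA => by
    rw [Matrix.trace_mul_comm]
    exact re_trace_mul_nonneg (portPullback_posSemidef N hA) hP hP2
  have hdom : ((((1 + s) * δ : ℝ) : ℂ) • P + ((1 + s⁻¹ : ℝ) : ℂ) • (1 - P) - T).PosSemidef := by
    -- The difference of the two sides is `s⁻¹ (s P - Q) T (s P - Q)` with `Q = 1 - P`.
    have h1 := (posSemidef_conj_of_isHermitian (B := (s : ℂ) • P - (1 - P)) (by
      rw [Matrix.IsHermitian, Matrix.conjTranspose_sub, Matrix.conjTranspose_smul, hP.eq, hQh.eq]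
      simp) hT).smul (show (0 : ℂ) ≤ ((s⁻¹ : ℝ) : ℂ) by exact_mod_cast (inv_pos.mpr hs).le)
    have h2 := hPT.smul (show (0 : ℂ) ≤ ((1 + s : ℝ) : ℂ) by exact_mod_cast (by positivity))
    have h3 := (posSemidef_conj_of_isHermitian hQh hT1).smul
      (show (0 : ℂ) ≤ ((1 + s⁻¹ : ℝ) : ℂ) by exact_mod_cast (by positivity))
    convert (h1.add h2).add h3 using 1
    have e1 : (1 - P) * (1 - T) * (1 - P) = (1 - P) - (1 - P) * T * (1 - P) := by
      rw [mul_sub (1 - P), mul_one, sub_mul (1 - P), hQ2]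
    rw [e1]
    have hT' : T = P * T * P + P * T * (1 - P) + (1 - P) * T * P + (1 - P) * T * (1 - P) := by
      noncomm_ring
    have e2 : ∀ Q : Matrix (Fin 2) (Fin 2) ℂ,
        (((s⁻¹ : ℝ) : ℂ)) • (((s : ℂ) • P - Q) * T * ((s : ℂ) • P - Q)) =
          (s : ℂ) • (P * T * P) - P * T * Q - Q * T * P + (((s⁻¹ : ℝ) : ℂ)) • (Q * T * Q) := by
      intro Q
      simp only [sub_mul, mul_sub, smul_mul_assoc, mul_smul_comm, smul_sub, smul_smul]
      push_cast
      rw [← mul_assoc, inv_mul_cancel₀ hsC, one_smul, one_smul, one_mul]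
      abel
    rw [e2]
    nth_rewrite 1 [hT']
    push_cast
    module
  have h := nonneg hdom
  have hPP : (P * portPullback N P).trace.re ≤ 1 := by
    have h0 : 0 ≤ (P * portPullback N (1 - P)).trace.re :=
      nonneg (posSemidef_of_isHermitian_of_mul_self hQh hQ2)
    have : portPullback N P + portPullback N (1 - P) = 1 := by
      rw [← portPullback_add, add_sub_cancel, portPullback_one]
    have h1 : (P * portPullback N P).trace.re + (P * portPullback N (1 - P)).trace.re = 1 := by
      rw [← Complex.add_re, ← Matrix.trace_add, ← mul_add, this, mul_one, hP1, Complex.one_re]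
    linarith
  have hPQ := re_trace_portPullback_compl_le N hP hP2
  rw [sub_eq_add_neg, ← neg_one_smul ℂ T, portPullback_add, portPullback_add, portPullback_smul,
    portPullback_smul, portPullback_smul, mul_add, mul_add, mul_smul_comm, mul_smul_comm,
    mul_smul_comm, Matrix.trace_add, Matrix.trace_add, Matrix.trace_smul, Matrix.trace_smul,
    Matrix.trace_smul, smul_eq_mul, smul_eq_mul, Complex.add_re, Complex.add_re,
    Complex.re_ofReal_mul, Complex.re_ofReal_mul] at h
  simp only [smul_eq_mul, neg_mul, one_mul, Complex.neg_re] at h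
  have hs' : 0 < s⁻¹ := inv_pos.mpr hs
  have a1 := mul_le_mul_of_nonneg_left hPP (show 0 ≤ (1 + s) * δ by positivity)
  have a2 := mul_le_mul_of_nonneg_left hPQ (show 0 ≤ 1 + s⁻¹ by positivity)
  linarith

end Pullback

/-! ### Relays -/

/-- If port `j` carries its own entangled register `H`, and the effects `C j` on (port `j`, `H`) and
`B j` on the other half of `H` are measured, then port `j` sees the effect `effective (C j) (B j)`. -/
theorem effective_kronecker_piTensor {N : ℕ} {H : Type} [Fintype H]
    (A : Matrix (Fin 2 × Bits N) (Fin 2 × Bits N) ℂ) (B : Fin N → Matrix H H ℂ)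
    (C : Fin N → Matrix (Fin 2 × H) (Fin 2 × H) ℂ) :
    effective ((A ⊗ₖ piTensor B).submatrix (Equiv.prodAssoc _ _ _).symm
        (Equiv.prodAssoc _ _ _).symm)
      ((piTensor C).submatrix
        (Equiv.arrowProdEquivProdArrow (Fin N) (fun _ => Fin 2) fun _ => H).symm
        (Equiv.arrowProdEquivProdArrow (Fin N) (fun _ => Fin 2) fun _ => H).symm) =
      effective A (piTensor fun j => effective (C j) (B j)) := by
  ext y y'
  simp only [effective, Fintype.sum_prod_type, Matrix.submatrix_apply, Matrix.kroneckerMap_apply,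
    Equiv.prodAssoc_symm_apply, Equiv.arrowProdEquivProdArrow_symm_apply, piTensor,
    Finset.prod_mul_distrib, Finset.prod_const, Finset.card_univ, Fintype.card_fin,
    Finset.prod_univ_sum, Fintype.piFinset_univ, Fintype.card_prod, Fintype.card_fun]
  rw [Nat.cast_mul, mul_inv, mul_assoc]
  congr 1
  simp_rw [Finset.mul_sum]
  refine Finset.sum_congr rfl fun z _ => ?_
  rw [Finset.sum_comm]
  refine Finset.sum_congr rfl fun z' _ => ?_
  refine Finset.sum_congr rfl fun h _ => Finset.sum_congr rfl fun h' _ => ?_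
  push_cast
  rw [inv_pow]
  ring

/-- The number of EPR pairs consumed by `k` nested layers of teleportation with `N` ports: each port
costs one pair and carries the pairs of the remaining layers. -/
def relayCost (N : ℕ) : ℕ → ℕ
  | 0 => 0
  | k + 1 => N * (relayCost N k + 1)

/-- A protocol by which a holder with classical data `x : X` and a helper with data `y : Y` identify
the bit `z` from the qubit `W x y |z⟩`, which the holder has. They share a maximally entangled state
on two copies of `H` (`relayCost N k` EPR pairs, arranged in `k` layers of teleportation), measure
without communicating, and compute a guess from the pair of outcomes in `OH` and `OO`. The guess is
wrong with probability at most `k ^ 2 * (6 / N)`, whichever bit was encoded. The inequality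
`error_le` is one of complex numbers, and includes that the left side is real. -/
structure Relay (X Y : Type) [MeasurableSpace X] [MeasurableSpace Y] (W : X → Y → U2)
    (N k : ℕ) where
  H : Type
  OH : Type
  OO : Type
  [fintypeH : Fintype H]
  [decidableEqH : DecidableEq H]
  [fintypeOH : Fintype OH]
  [fintypeOO : Fintype OO]
  card_H : Fintype.card H = 2 ^ relayCost N k
  holder : X → OH → Matrix (Fin 2 × H) (Fin 2 × H) ℂ
  helper : Y → OO → Matrix H H ℂ
  guess : OH → OO → Fin 2
  holder_posSemidef : ∀ x a, (holder x a).PosSemidef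
  helper_posSemidef : ∀ y b, (helper y b).PosSemidef
  sum_holder : ∀ x, ∑ a, holder x a = 1
  sum_helper : ∀ y, ∑ b, helper y b = 1
  measurable_holder : ∀ a p q, Measurable fun x => holder x a p q
  measurable_helper : ∀ b p q, Measurable fun y => helper y b p q
  error_le : ∀ x y, ∀ z z' : Fin 2, z ≠ z' →
    ((W x y : Matrix (Fin 2) (Fin 2) ℂ)ᴴ * (∑ p : OH × OO, if guess p.1 p.2 = z then
      effective (holder x p.1) (helper y p.2) else 0) * (W x y : Matrix (Fin 2) (Fin 2) ℂ)) z' z' ≤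
    (((k : ℝ) ^ 2 * (6 / N) : ℝ) : ℂ)

attribute [instance] Relay.fintypeH Relay.decidableEqH Relay.fintypeOH Relay.fintypeOO

theorem measurable_U2_entry (a b : Fin 2) :
    Measurable fun u : U2 => (u : Matrix (Fin 2) (Fin 2) ℂ) a b :=
  (continuous_subtype_val.matrix_elem a b).measurable

theorem U2_conjTranspose_mul (u : U2) :
    (u : Matrix (Fin 2) (Fin 2) ℂ)ᴴ * (u : Matrix (Fin 2) (Fin 2) ℂ) = 1 :=
  Unitary.coe_star_mul_self u

theorem U2_mul_conjTranspose (u : U2) :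
    (u : Matrix (Fin 2) (Fin 2) ℂ) * (u : Matrix (Fin 2) (Fin 2) ℂ)ᴴ = 1 :=
  Unitary.coe_mul_star_self u

/-! ### Building relays -/

section Base

variable {X Y : Type} [MeasurableSpace X] [MeasurableSpace Y]

/-- The holder knows the whole unitary, and measures in the rotated basis. -/
def Relay.base (N : ℕ) (g : X → U2) (hg : Measurable g) : Relay X Y (fun x _ => g x) N 0 where
  H := Unit
  OH := Fin 2
  OO := Unit
  card_H := by simp [relayCost]
  holder x a := ((g x : Matrix (Fin 2) (Fin 2) ℂ) * Matrix.single a a 1 *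
    (g x : Matrix (Fin 2) (Fin 2) ℂ)ᴴ).submatrix Prod.fst Prod.fst
  helper _ _ := 1
  guess a _ := a
  holder_posSemidef x a := by
    refine Matrix.PosSemidef.submatrix (Matrix.PosSemidef.mul_mul_conjTranspose_same ?_ _) _
    rw [← Matrix.diagonal_single]
    exact Matrix.PosSemidef.diagonal (Pi.single_nonneg.mpr zero_le_one)
  helper_posSemidef _ _ := Matrix.PosSemidef.one
  sum_holder x := by
    have h : ∑ a : Fin 2, (g x : Matrix (Fin 2) (Fin 2) ℂ) * Matrix.single a a 1 *
        (g x : Matrix (Fin 2) (Fin 2) ℂ)ᴴ = 1 := by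
      rw [← Finset.sum_mul, ← Finset.mul_sum, Matrix.sum_single_one, mul_one,
        U2_mul_conjTranspose]
    ext p q
    have := congrFun₂ h p.1 q.1
    rw [Matrix.sum_apply] at this ⊢
    simpa [Matrix.one_apply, Prod.ext_iff] using this
  sum_helper _ := by simp
  measurable_holder a p q := by
    simp only [Matrix.submatrix_apply, Matrix.mul_apply, Matrix.conjTranspose_apply]
    have := fun i j => (measurable_U2_entry i j).comp hg
    simp only [Function.comp_def] at this
    fun_prop
  measurable_helper _ _ _ := measurable_const
  error_le x y z z' hz := by
    have h : (∑ p : Fin 2 × Unit, if p.1 = z then effective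
        (((g x : Matrix (Fin 2) (Fin 2) ℂ) * Matrix.single p.1 p.1 1 *
          (g x : Matrix (Fin 2) (Fin 2) ℂ)ᴴ).submatrix Prod.fst Prod.fst)
        (1 : Matrix Unit Unit ℂ) else 0) = (g x : Matrix (Fin 2) (Fin 2) ℂ) *
          Matrix.single z z 1 * (g x : Matrix (Fin 2) (Fin 2) ℂ)ᴴ := by
      rw [Fintype.sum_prod_type]
      ext i j
      simp [effective]
    rw [h, ← mul_assoc, ← mul_assoc, U2_conjTranspose_mul, one_mul, mul_assoc,
      U2_conjTranspose_mul, mul_one]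
    simp [hz]

end Base

section Step

variable {X Y : Type} [MeasurableSpace X] [MeasurableSpace Y]

namespace Relay
variable {W : X → Y → U2} {N k : ℕ} (R : Relay X Y W N k)

/-- The effect on the holder's qubit of the guess `z`. -/
def answerEffect (x : X) (y : Y) (z : Fin 2) : Matrix (Fin 2) (Fin 2) ℂ :=
  ∑ p : R.OH × R.OO, if R.guess p.1 p.2 = z then effective (R.holder x p.1) (R.helper y p.2) else 0

instance : Nonempty R.H := Fintype.card_pos_iff.mp (by rw [R.card_H]; positivity)

theorem effective_posSemidef (x : X) (y : Y) (p : R.OH × R.OO) :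
    (effective (R.holder x p.1) (R.helper y p.2)).PosSemidef :=
  InterleavedProduct.effective_posSemidef (R.holder_posSemidef x p.1) (R.helper_posSemidef y p.2)

theorem sum_effective (x : X) (y : Y) :
    ∑ p : R.OH × R.OO, effective (R.holder x p.1) (R.helper y p.2) = 1 := by
  rw [Fintype.sum_prod_type]
  simp only [← effective_sum_right, R.sum_helper, ← effective_sum_left, R.sum_holder,
    effective_one]

theorem answerEffect_posSemidef (x : X) (y : Y) (z : Fin 2) :
    (R.answerEffect x y z).PosSemidef :=
  Matrix.posSemidef_sum _ fun p _ => by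
    split_ifs
    · exact R.effective_posSemidef x y p
    · exact Matrix.PosSemidef.zero

theorem one_sub_answerEffect_posSemidef (x : X) (y : Y) (z : Fin 2) :
    (1 - R.answerEffect x y z).PosSemidef := by
  rw [← R.sum_effective x y, answerEffect, ← Finset.sum_sub_distrib]
  refine Matrix.posSemidef_sum _ fun p _ => ?_
  split_ifs
  · rw [sub_self]
    exact Matrix.PosSemidef.zero
  · rw [sub_zero]
    exact R.effective_posSemidef x y p

/-- The relays in the ports other than `i` have no influence: summed over their outcomes, they
contribute identities. -/
theorem sum_piTensor_ite_guess (x : X) (y : Y) (z : Fin 2) (i : Fin N) :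
    ∑ b : Fin N → R.OO, ∑ c : Fin N → R.OH, (if R.guess (c i) (b i) = z then
      piTensor fun j => effective (R.holder x (c j)) (R.helper y (b j)) else 0) =
      tensorAt i (R.answerEffect x y z) := by
  classical
  have h := sum_piTensor (fun (j : Fin N) (p : R.OH × R.OO) =>
    if j = i then (if R.guess p.1 p.2 = z then effective (R.holder x p.1) (R.helper y p.2) else 0)
    else effective (R.holder x p.1) (R.helper y p.2))
  have hr : (fun j : Fin N => ∑ p : R.OH × R.OO,
      if j = i then (if R.guess p.1 p.2 = z then effective (R.holder x p.1) (R.helper y p.2) else 0)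
      else effective (R.holder x p.1) (R.helper y p.2)) =
      fun j => if j = i then R.answerEffect x y z else 1 := by
    funext j
    split_ifs
    · rfl
    · exact R.sum_effective x y
  rw [hr] at h
  rw [tensorAt, ← h, Finset.sum_comm, ← Fintype.sum_prod_type']
  symm
  refine Fintype.sum_equiv
    (Equiv.arrowProdEquivProdArrow (Fin N) (fun _ => R.OH) fun _ => R.OO) _ _ fun d => ?_
  simp only [Equiv.arrowProdEquivProdArrow_apply]
  ext p q
  split_ifs with hd
  · refine Finset.prod_congr rfl fun j _ => ?_
    by_cases hj : j = i
    · subst hj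
      simp [hd]
    · simp [hj]
  · exact Finset.prod_eq_zero (Finset.mem_univ i) (by simp [hd])

end Relay
end Step

namespace Relay

variable {X Y : Type} [MeasurableSpace X] [MeasurableSpace Y]
variable {W : Y → X → U2} {N k : ℕ} (R : Relay Y X W N k) (g : X → U2)

/-- The measurement of the partner of a teleporting party: in every port, as the holder of the inner
relay. -/
def stepHelper (y : Y) (c : Fin N → R.OH) :
    Matrix (Bits N × (Fin N → R.H)) (Bits N × (Fin N → R.H)) ℂ :=
  (piTensor fun j => R.holder y (c j)).submatrix
    (Equiv.arrowProdEquivProdArrow (Fin N) (fun _ => Fin 2) fun _ => R.H).symm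
    (Equiv.arrowProdEquivProdArrow (Fin N) (fun _ => Fin 2) fun _ => R.H).symm

theorem sum_stepHelper (y : Y) : ∑ c, R.stepHelper y c = 1 := by
  have h := sum_piTensor (fun (_ : Fin N) (o : R.OH) => R.holder y o)
  simp only [R.sum_holder, piTensor_one] at h
  have := congrArg (fun A => A.submatrix
    (Equiv.arrowProdEquivProdArrow (Fin N) (fun _ => Fin 2) fun _ => R.H).symm
    (Equiv.arrowProdEquivProdArrow (Fin N) (fun _ => Fin 2) fun _ => R.H).symm) h
  simp only [Matrix.submatrix_one_equiv] at this
  rw [← this]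
  ext p q
  simp only [Matrix.sum_apply, Matrix.submatrix_apply, stepHelper]

variable [NeZero N]

/-- The measurement of the teleporting party: the unitary `(g x)⁻¹` is undone, the qubit is teleported
through the ports, and every port is served as the helper of the inner relay. -/
def stepHolder (x : X) (a : Fin N × (Fin N → R.OO)) :
    Matrix (Fin 2 × Bits N × (Fin N → R.H)) (Fin 2 × Bits N × (Fin N → R.H)) ℂ :=
  ((((g x : Matrix (Fin 2) (Fin 2) ℂ) ⊗ₖ (1 : Matrix (Bits N) (Bits N) ℂ)) * portEffect a.1 *
    ((g x : Matrix (Fin 2) (Fin 2) ℂ) ⊗ₖ (1 : Matrix (Bits N) (Bits N) ℂ))ᴴ) ⊗ₖ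
      piTensor fun j => R.helper x (a.2 j)).submatrix
    (Equiv.prodAssoc _ _ _).symm (Equiv.prodAssoc _ _ _).symm

theorem sum_stepHolder (x : X) : ∑ a, R.stepHolder g x a = 1 := by
  have h : ∑ a : Fin N × (Fin N → R.OO),
      ((((g x : Matrix (Fin 2) (Fin 2) ℂ) ⊗ₖ (1 : Matrix (Bits N) (Bits N) ℂ)) * portEffect a.1 *
        ((g x : Matrix (Fin 2) (Fin 2) ℂ) ⊗ₖ (1 : Matrix (Bits N) (Bits N) ℂ))ᴴ) ⊗ₖ
        piTensor fun j => R.helper x (a.2 j)) = 1 := by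
    have hb := sum_piTensor (fun (_ : Fin N) (o : R.OO) => R.helper x o)
    simp only [R.sum_helper, piTensor_one] at hb
    have ha : ∑ i : Fin N, ((g x : Matrix (Fin 2) (Fin 2) ℂ) ⊗ₖ (1 : Matrix (Bits N) (Bits N) ℂ)) *
        portEffect i * ((g x : Matrix (Fin 2) (Fin 2) ℂ) ⊗ₖ (1 : Matrix (Bits N) (Bits N) ℂ))ᴴ =
        1 := by
      rw [← Finset.sum_mul, ← Finset.mul_sum, sum_portEffect, mul_one,
        Matrix.conjTranspose_kronecker, ← Matrix.mul_kronecker_mul, U2_mul_conjTranspose]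
      simp
    rw [← Matrix.one_kronecker_one, ← ha, ← hb, Fintype.sum_prod_type]
    ext p q
    simp only [Matrix.sum_apply, Matrix.kroneckerMap_apply, Finset.sum_mul_sum]
  have := congrArg (fun A => A.submatrix (Equiv.prodAssoc (Fin 2) (Bits N) (Fin N → R.H)).symm
    (Equiv.prodAssoc (Fin 2) (Bits N) (Fin N → R.H)).symm) h
  simp only [Matrix.submatrix_one_equiv] at this
  rw [← this]
  ext p q
  simp only [Matrix.sum_apply, Matrix.submatrix_apply, stepHolder]

theorem sum_effective_step (x : X) (y : Y) (z : Fin 2) :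
    (∑ p : (Fin N × (Fin N → R.OO)) × (Fin N → R.OH),
      if R.guess (p.2 p.1.1) (p.1.2 p.1.1) = z then
        effective (R.stepHolder g x p.1) (R.stepHelper y p.2) else 0) =
      (g x : Matrix (Fin 2) (Fin 2) ℂ) * portPullback N (R.answerEffect y x z) *
        (g x : Matrix (Fin 2) (Fin 2) ℂ)ᴴ := by
  simp only [stepHolder, stepHelper, effective_kronecker_piTensor, effective_kronecker_one_conj,
    Fintype.sum_prod_type, portPullback, ← R.sum_piTensor_ite_guess y x z, effective_sum_right,
    Finset.mul_sum, Finset.sum_mul]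
  refine Finset.sum_congr rfl fun i _ => Finset.sum_congr rfl fun b _ =>
    Finset.sum_congr rfl fun c _ => ?_
  split_ifs
  · rfl
  · rw [show effective (portEffect i) (0 : Matrix (Bits N) (Bits N) ℂ) = 0 by
      ext; simp [effective], mul_zero, zero_mul]

/-- With `δ = k ^ 2 * (6 / N)`, the bound `(1 + s) δ + (1 + s⁻¹) (6 / N)` is minimal at `s = k⁻¹`,
where it equals `(k + 1) ^ 2 * (6 / N)`. -/
theorem re_portPullback_entry_le (x : X) (y : Y) {z z' : Fin 2} (hz : z ≠ z') :
    ((W y x : Matrix (Fin 2) (Fin 2) ℂ)ᴴ * portPullback N (R.answerEffect y x z) *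
      (W y x : Matrix (Fin 2) (Fin 2) ℂ)) z' z' ≤
    ((((k + 1 : ℕ) : ℝ) ^ 2 * (6 / N) : ℝ) : ℂ) := by
  have hN : (0 : ℝ) < N := Nat.cast_pos.mpr (NeZero.pos N)
  set w : Matrix (Fin 2) (Fin 2) ℂ := (W y x : Matrix (Fin 2) (Fin 2) ℂ) with hw
  have hw1 : wᴴ * w = 1 := U2_conjTranspose_mul _
  set e : Matrix (Fin 2) (Fin 2) ℂ := Matrix.single z' z' 1 with he
  set T := R.answerEffect y x z
  have hee : e * e = e := by simp [he]
  have heh : eᴴ = e := by simp [he, Matrix.conjTranspose_single]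
  have heAe : ∀ A : Matrix (Fin 2) (Fin 2) ℂ, e * A * e = A z' z' • e := fun A => by
    simp [he, Matrix.single_mul_mul_single, Matrix.smul_single]
  have htr : ∀ A : Matrix (Fin 2) (Fin 2) ℂ, (w * e * wᴴ * A).trace = (wᴴ * A * w) z' z' := by
    intro A
    rw [mul_assoc, mul_assoc, Matrix.trace_mul_comm, mul_assoc, Matrix.trace_single_mul]
    simp
  have hT := R.answerEffect_posSemidef y x z
  have hent := (hT.conjTranspose_mul_mul_same w).diag_nonneg (i := z')
  have hle : (wᴴ * T * w) z' z' ≤ (((k : ℝ) ^ 2 * (6 / N) : ℝ) : ℂ) := R.error_le y x z z' hz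
  have main : ∀ s : ℝ, 0 < s → ((wᴴ * portPullback N T * w) z' z').re ≤
      (1 + s) * ((k : ℝ) ^ 2 * (6 / N)) + (1 + s⁻¹) * (6 / N) := by
    intro s hs
    rw [← htr]
    refine re_trace_portPullback_le N ?_ ?_ ?_ hT (R.one_sub_answerEffect_posSemidef y x z)
      (by positivity) ?_ hs
    · rw [Matrix.IsHermitian, Matrix.conjTranspose_mul, Matrix.conjTranspose_mul,
        Matrix.conjTranspose_conjTranspose, heh, mul_assoc]
    · calc w * e * wᴴ * (w * e * wᴴ) = w * e * (wᴴ * w) * e * wᴴ := by noncomm_ring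
        _ = w * (e * e) * wᴴ := by rw [hw1]; noncomm_ring
        _ = _ := by rw [hee]
    · rw [← mul_one (w * e * wᴴ), htr, mul_one, hw1]
      simp
    · have h1 : w * e * wᴴ * T * (w * e * wᴴ) = (wᴴ * T * w) z' z' • (w * e * wᴴ) := by
        calc w * e * wᴴ * T * (w * e * wᴴ) = w * (e * (wᴴ * T * w) * e) * wᴴ := by noncomm_ring
          _ = _ := by rw [heAe]; simp
      rw [h1, ← sub_smul]
      refine Matrix.PosSemidef.smul (Matrix.PosSemidef.mul_mul_conjTranspose_same ?_ _)
        (sub_nonneg.mpr hle)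
      refine posSemidef_of_isHermitian_of_mul_self heh hee
  have hre : ((wᴴ * portPullback N T * w) z' z').re ≤ ((k + 1 : ℕ) : ℝ) ^ 2 * (6 / N) := by
    rcases Nat.eq_zero_or_pos k with rfl | hk
    -- For `k = 0` the bound `6 / N` is the limit as `s` tends to infinity.
    · refine le_of_forall_pos_le_add fun ε hε => (main (6 / N / ε) (by positivity)).trans ?_
      apply le_of_eq
      push_cast
      field_simp
      ring
    · have hk' : (0 : ℝ) < k := Nat.cast_pos.mpr hk
      refine (main (k : ℝ)⁻¹ (by positivity)).trans (le_of_eq ?_)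
      push_cast
      field_simp
      ring
  have hent' := ((portPullback_posSemidef N hT).conjTranspose_mul_mul_same w).diag_nonneg (i := z')
  rw [Complex.le_def] at hent' ⊢
  exact ⟨by rwa [Complex.ofReal_re], by rw [Complex.ofReal_im]; exact hent'.2.symm⟩

/-- One more layer of teleportation. The party who knows the leftmost factor `g x` undoes it and
teleports the qubit to the partner, who becomes the holder of the inner relay `R`; the roles of `X`
and `Y` are exchanged. -/
def step (hg : Measurable g) : Relay X Y (fun x y => g x * W y x) N (k + 1) where
  H := Bits N × (Fin N → R.H)
  OH := Fin N × (Fin N → R.OO)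
  OO := Fin N → R.OH
  card_H := by
    rw [Fintype.card_prod, Fintype.card_fun, Fintype.card_fun, Fintype.card_fin, Fintype.card_fin,
      R.card_H, relayCost, ← pow_mul, ← pow_add]
    ring
  holder := R.stepHolder g
  helper := R.stepHelper
  guess a c := R.guess (c a.1) (a.2 a.1)
  holder_posSemidef x a := (((posSemidef_portEffect a.1).mul_mul_conjTranspose_same _).kronecker
    (piTensor_posSemidef fun _ => R.helper_posSemidef _ _)).submatrix _
  helper_posSemidef y c := (piTensor_posSemidef fun _ => R.holder_posSemidef _ _).submatrix _
  sum_holder := R.sum_stepHolder g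
  sum_helper := R.sum_stepHelper
  measurable_holder a p q := by
    simp only [stepHolder, Matrix.submatrix_apply, Matrix.kroneckerMap_apply, Matrix.mul_apply,
      Matrix.conjTranspose_apply, piTensor]
    have h1 := fun i j => (measurable_U2_entry i j).comp hg
    have h2 := R.measurable_helper
    simp only [Function.comp_def] at h1
    fun_prop
  measurable_helper c p q := by
    simp only [stepHelper, Matrix.submatrix_apply, piTensor]
    exact Finset.measurable_prod _ fun _ _ => R.measurable_holder _ _ _
  error_le x y z z' hz := by
    rw [R.sum_effective_step g x y z]
    refine le_of_eq_of_le (congrArg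
      (fun A : Matrix (Fin 2) (Fin 2) ℂ => A z' z') ?_) (R.re_portPullback_entry_le x y hz)
    rw [Submonoid.coe_mul, Matrix.conjTranspose_mul]
    have h := U2_conjTranspose_mul (g x)
    set G : Matrix (Fin 2) (Fin 2) ℂ := (g x : Matrix (Fin 2) (Fin 2) ℂ)
    set w : Matrix (Fin 2) (Fin 2) ℂ := (W y x : Matrix (Fin 2) (Fin 2) ℂ)
    calc wᴴ * Gᴴ * (G * portPullback N (R.answerEffect y x z) * Gᴴ) * (G * w)
        = wᴴ * (Gᴴ * G) * portPullback N (R.answerEffect y x z) * (Gᴴ * G) * w := by noncomm_ring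
      _ = _ := by rw [h]; noncomm_ring

end Relay

/-- Peeling off the factors of `∏ j, u j * v j` one by one, with a layer of teleportation between any
two consecutive factors. The last factor needs none. -/
theorem Relay.nonempty_of_list {t : ℕ} (N : ℕ) [NeZero N] (i : Fin t) (l : List (Fin t)) :
    Nonempty (Relay (Fin t → U2) (Fin t → U2)
      (fun u v => (l.map fun j => u j * v j).prod * (u i * v i)) N (2 * l.length + 1)) := by
  induction l with
  | nil =>
    have R : Relay (Fin t → U2) (Fin t → U2) (fun u v => u i * v i) N 1 :=
      (Relay.base N (fun v : Fin t → U2 => v i) (measurable_pi_apply i)).step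
        (fun u : Fin t → U2 => u i)
        (measurable_pi_apply i)
    simpa using ⟨R⟩
  | cons j l ih =>
    obtain ⟨R⟩ := ih
    have R' := (R.step (fun v => v j) (measurable_pi_apply j)).step (fun u => u j)
      (measurable_pi_apply j)
    simp only [List.map_cons, List.prod_cons, mul_assoc, List.length_cons] at R' ⊢
    exact ⟨R'⟩

/-- The summand `2` makes the induction work. -/
theorem relayCost_add_two_le {N : ℕ} (hN : 2 ≤ N) (k : ℕ) : relayCost N k + 2 ≤ N ^ (k + 1) := by
  induction k with
  | zero => simpa [relayCost] using hN
  | succ k ih =>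
    calc relayCost N (k + 1) + 2 ≤ N * (relayCost N k + 1) + N := by rw [relayCost]; omega
      _ = N * (relayCost N k + 2) := by ring
      _ ≤ N * N ^ (k + 1) := Nat.mul_le_mul_left N ih
      _ = N ^ (k + 1 + 1) := by ring

/-! ### Tail bounds for independent errors -/

/-- Hoeffding's lemma for a Bernoulli variable. -/
theorem bernoulli_mgf_le {q : ℝ} (h0 : 0 ≤ q) (h1 : q ≤ 1) (r : ℝ) :
    1 - q + q * Real.exp r ≤ Real.exp (r * q + r ^ 2 / 8) := by
  set μ : Measure ℝ := ENNReal.ofReal (1 - q) • Measure.dirac 0 + ENNReal.ofReal q • Measure.dirac 1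
    with hμ
  have hp : IsProbabilityMeasure μ := ⟨by
    simp [hμ, ← ENNReal.ofReal_add (sub_nonneg.mpr h1) h0]⟩
  have hint : ∀ f : ℝ → ℝ, ∫ x, f x ∂μ = (1 - q) * f 0 + q * f 1 := by
    intro f
    have hd : ∀ (c a : ℝ), Integrable f (ENNReal.ofReal c • Measure.dirac a) := fun c a =>
      (integrable_dirac (by simp)).smul_measure ENNReal.ofReal_ne_top
    rw [hμ, integral_add_measure (hd _ _) (hd _ _), integral_smul_measure, integral_smul_measure,
      integral_dirac, integral_dirac, ENNReal.toReal_ofReal (sub_nonneg.mpr h1),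
      ENNReal.toReal_ofReal h0, smul_eq_mul, smul_eq_mul]
  have hsub := ProbabilityTheory.hasSubgaussianMGF_of_mem_Icc (μ := μ) (X := id) (a := 0) (b := 1)
    aemeasurable_id (by
      have : ∀ c a : ℝ, a ∈ Set.Icc (0 : ℝ) 1 →
          ∀ᵐ x ∂(ENNReal.ofReal c • Measure.dirac a), id x ∈ Set.Icc (0 : ℝ) 1 := fun c a ha =>
        Measure.ae_smul_measure ((ae_dirac_iff measurableSet_Icc).mpr ha) _
      rw [hμ, ae_add_measure_iff]
      exact ⟨this _ _ (by simp), this _ _ (by simp)⟩)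
  have := hsub.mgf_le r
  rw [ProbabilityTheory.mgf, hint, hint] at this
  have e : 1 - q + q * Real.exp r = Real.exp (r * q) *
      ((1 - q) * Real.exp (r * (0 - q)) + q * Real.exp (r * (1 - q))) := by
    rw [mul_add, mul_left_comm, mul_left_comm _ q, ← Real.exp_add, ← Real.exp_add]
    ring_nf
    simp
    ring
  rw [e, Real.exp_add]
  refine mul_le_mul_of_nonneg_left ?_ (Real.exp_pos _).le
  have hc : (((‖(1 : ℝ) - 0‖₊ / 2) ^ 2 : NNReal) : ℝ) = 1 / 4 := by
    push_cast
    norm_num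
  rw [hc] at this
  simp only [id, mul_zero, mul_one, zero_add] at this
  exact this.trans_eq (by ring_nf)

section Tail

variable {n : ℕ} {O : Type} [Fintype O] {p : Fin n → O → ℝ} {bad : Fin n → O → Prop}
  [∀ i o, Decidable (bad i o)] {η : ℝ}

theorem sum_prod_eq_one (hp1 : ∀ i, ∑ o, p i o = 1) : ∑ d : Fin n → O, ∏ i, p i (d i) = 1 := by
  simpa [hp1, Fintype.piFinset_univ] using
    (Finset.prod_univ_sum (fun _ : Fin n => (Finset.univ : Finset O)) p).symm

/-- Markov's inequality for the number of errors. -/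
theorem sum_tail_le (hp : ∀ i o, 0 ≤ p i o) (hp1 : ∀ i, ∑ o, p i o = 1) (hη : 0 < η)
    (hbad : ∀ i, ∑ o, (if bad i o then p i o else 0) ≤ η ^ 2) :
    ∑ d : Fin n → O, (if ((Finset.univ.filter fun i => bad i (d i)).card : ℝ) ≤ η * n then 0
      else ∏ i, p i (d i)) ≤ η := by
  rcases Nat.eq_zero_or_pos n with rfl | hn
  · simpa using hη.le
  have hn' : (0 : ℝ) < n := Nat.cast_pos.mpr hn
  have h1 : ∀ d : Fin n → O,
      η * n * (if ((Finset.univ.filter fun i => bad i (d i)).card : ℝ) ≤ η * n then 0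
        else ∏ i, p i (d i)) ≤ ∑ i, (if bad i (d i) then 1 else 0) * ∏ j, p j (d j) := by
    intro d
    have h0 : 0 ≤ ∏ j, p j (d j) := Finset.prod_nonneg fun j _ => hp _ _
    rw [← Finset.sum_mul, Finset.sum_boole]
    split_ifs with h
    · rw [mul_zero]
      positivity
    · exact mul_le_mul_of_nonneg_right (not_le.mp h).le h0
  have h2 : ∀ i, ∑ d : Fin n → O, (if bad i (d i) then 1 else 0) * ∏ j, p j (d j) ≤ η ^ 2 := by
    intro i
    have : ∀ d : Fin n → O, (if bad i (d i) then 1 else 0) * ∏ j, p j (d j) =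
        ∏ j, if j = i then (if bad i (d j) then p j (d j) else 0) else p j (d j) := by
      intro d
      rw [← Finset.mul_prod_erase _ _ (Finset.mem_univ i),
        ← Finset.mul_prod_erase _ (fun j => if j = i then _ else _) (Finset.mem_univ i), if_pos rfl,
        ← mul_assoc]
      congr 1
      · simp
      · exact Finset.prod_congr rfl fun j hj => (if_neg (Finset.ne_of_mem_erase hj)).symm
    simp only [this]
    have e := Finset.prod_univ_sum (fun _ : Fin n => (Finset.univ : Finset O))
      (fun j o => if j = i then (if bad i o then p j o else 0) else p j o)
    rw [Fintype.piFinset_univ] at e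
    rw [← e, ← Finset.mul_prod_erase _ _ (Finset.mem_univ i),
      Finset.prod_eq_one (s := Finset.univ.erase i) fun j hj => by
        simp [Finset.ne_of_mem_erase hj, hp1]]
    simpa using hbad i
  have h3 := Finset.sum_le_sum fun d (_ : d ∈ Finset.univ) => h1 d
  rw [← Finset.mul_sum, Finset.sum_comm] at h3
  have h4 := h3.trans (Finset.sum_le_sum fun i _ => h2 i)
  rw [Finset.sum_const, Finset.card_univ, Fintype.card_fin, nsmul_eq_mul] at h4
  have h5 : η * n * _ ≤ η * n * η := h4.trans_eq (by ring)
  exact le_of_mul_le_mul_left h5 (by positivity)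

/-- The Chernoff–Hoeffding bound for the number of errors. -/
theorem sum_tail_le_exp (hp : ∀ i o, 0 ≤ p i o) (hp1 : ∀ i, ∑ o, p i o = 1) (hη : 0 < η)
    (hη1 : η ≤ 1) (hbad : ∀ i, ∑ o, (if bad i o then p i o else 0) ≤ η ^ 2) :
    ∑ d : Fin n → O, (if ((Finset.univ.filter fun i => bad i (d i)).card : ℝ) ≤ η * n then 0
      else ∏ i, p i (d i)) ≤ Real.exp (-2 * n * (η - η ^ 2) ^ 2) := by
  -- The exponent `-r (η - η ^ 2) + r ^ 2 / 8` is minimal at this `r`.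
  set r : ℝ := 4 * (η - η ^ 2) with hr
  have hr0 : 0 ≤ r := by rw [hr]; nlinarith
  have h1 : ∀ d : Fin n → O,
      (if ((Finset.univ.filter fun i => bad i (d i)).card : ℝ) ≤ η * n then 0
        else ∏ i, p i (d i)) ≤ Real.exp (-(r * (η * n))) *
          ∏ i, (p i (d i) * if bad i (d i) then Real.exp r else 1) := by
    intro d
    have h0 : 0 ≤ ∏ j, p j (d j) := Finset.prod_nonneg fun j _ => hp _ _
    rw [Finset.prod_mul_distrib, Finset.prod_ite, Finset.prod_const, Finset.prod_const_one, mul_one,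
      ← Real.exp_nat_mul, mul_left_comm, ← Real.exp_add]
    split_ifs with h
    · positivity
    · refine le_mul_of_one_le_right h0 (Real.one_le_exp ?_)
      nlinarith [mul_le_mul_of_nonneg_left (not_le.mp h).le hr0]
  have h2 : ∀ i, ∑ o, (p i o * if bad i o then Real.exp r else 1) ≤
      Real.exp (r * η ^ 2 + r ^ 2 / 8) := by
    intro i
    set q := ∑ o, (if bad i o then p i o else 0) with hq
    have hq0 : 0 ≤ q := Finset.sum_nonneg fun o _ => by split_ifs <;> [exact hp i o; rfl]
    have hq1 : q ≤ 1 := (hbad i).trans (pow_le_one₀ hη.le hη1)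
    have e : ∑ o, (p i o * if bad i o then Real.exp r else 1) = 1 - q + q * Real.exp r := by
      have e1 : ∀ o, (p i o * if bad i o then Real.exp r else 1) = p i o -
          (if bad i o then p i o else 0) + (if bad i o then p i o else 0) * Real.exp r := fun o => by
        split_ifs <;> ring
      simp only [e1, Finset.sum_add_distrib, Finset.sum_sub_distrib, ← Finset.sum_mul, hp1, hq]
    rw [e]
    refine (bernoulli_mgf_le hq0 hq1 r).trans (Real.exp_le_exp.mpr ?_)
    nlinarith [mul_le_mul_of_nonneg_left (hbad i) hr0]
  refine (Finset.sum_le_sum fun d _ => h1 d).trans ?_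
  have e := Finset.prod_univ_sum (fun _ : Fin n => (Finset.univ : Finset O))
    (fun i o => p i o * if bad i o then Real.exp r else 1)
  rw [Fintype.piFinset_univ] at e
  rw [← Finset.mul_sum, ← e]
  have h3 : ∏ i, ∑ o, (p i o * if bad i o then Real.exp r else 1) ≤
      ∏ _i : Fin n, Real.exp (r * η ^ 2 + r ^ 2 / 8) :=
    Finset.prod_le_prod (fun i _ => Finset.sum_nonneg fun o _ => mul_nonneg (hp i o)
      (by split_ifs <;> positivity)) fun i _ => h2 i
  rw [Finset.prod_const, Finset.card_univ, Fintype.card_fin, ← Real.exp_nat_mul] at h3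
  refine (mul_le_mul_of_nonneg_left h3 (Real.exp_pos _).le).trans ?_
  rw [← Real.exp_add]
  refine Real.exp_le_exp.mpr (le_of_eq ?_)
  rw [hr]
  ring

theorem one_sub_min_le_sum (hp : ∀ i o, 0 ≤ p i o) (hp1 : ∀ i, ∑ o, p i o = 1) (hη : 0 < η)
    (hη1 : η ≤ 1) (hbad : ∀ i, ∑ o, (if bad i o then p i o else 0) ≤ η ^ 2) :
    1 - min η (Real.exp (-2 * n * (η - η ^ 2) ^ 2)) ≤
      ∑ d : Fin n → O, (if ((Finset.univ.filter fun i => bad i (d i)).card : ℝ) ≤ η * n then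
        ∏ i, p i (d i) else 0) := by
  have h := le_min (sum_tail_le hp hp1 hη hbad) (sum_tail_le_exp hp hp1 hη hη1 hbad)
  have e := sum_prod_eq_one hp1
  have : ∑ d : Fin n → O, (if ((Finset.univ.filter fun i => bad i (d i)).card : ℝ) ≤ η * n then
        ∏ i, p i (d i) else 0) +
      ∑ d : Fin n → O, (if ((Finset.univ.filter fun i => bad i (d i)).card : ℝ) ≤ η * n then 0
        else ∏ i, p i (d i)) = 1 := by
    rw [← Finset.sum_add_distrib, ← e]
    exact Finset.sum_congr rfl fun d _ => by split_ifs <;> simp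
  linarith

end Tail

/-! ### The attack with one relay for each qubit -/

theorem jointState_apply {n M : ℕ} (ψ : Bits n → ℂ) (y : Bits n) (h h' : Bits M) :
    jointState M ψ ((y, h), h') =
      if h = h' then ψ y * ((1 / Real.sqrt 2 : ℝ) : ℂ) ^ M else 0 := by
  simp only [jointState, Finset.prod_ite_zero, Finset.mem_univ, true_implies, Finset.prod_const,
    Finset.card_univ, Fintype.card_fin, funext_iff, mul_ite, mul_zero]

/-- Born's rule for the joint state of challenge and EPR pairs, in terms of the effective effect on
the challenge. -/
theorem star_jointState_dotProduct {n M : ℕ} (ψ : Bits n → ℂ)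
    (A : Matrix (Bits n × Bits M) (Bits n × Bits M) ℂ) (B : Matrix (Bits M) (Bits M) ℂ) :
    star (jointState M ψ) ⬝ᵥ ((A ⊗ₖ B) *ᵥ jointState M ψ) = star ψ ⬝ᵥ (effective A B *ᵥ ψ) := by
  have hs : ((1 / Real.sqrt 2 : ℝ) : ℂ) ^ M * ((1 / Real.sqrt 2 : ℝ) : ℂ) ^ M =
      (Fintype.card (Bits M) : ℂ)⁻¹ := by
    rw [← mul_pow, ← Complex.ofReal_mul, div_mul_div_comm, Real.mul_self_sqrt (by norm_num)]
    simp
  simp only [dotProduct, Matrix.mulVec, Fintype.sum_prod_type, Pi.star_apply, jointState_apply,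
    apply_ite star, star_zero, ite_mul, zero_mul, Finset.sum_ite_eq, Finset.mem_univ, if_true,
    mul_ite, mul_zero, Matrix.kroneckerMap_apply, effective, ← hs]
  refine Finset.sum_congr rfl fun y _ => ?_
  simp only [Finset.mul_sum, Finset.sum_mul]
  rw [Finset.sum_comm]
  refine Finset.sum_congr rfl fun y' _ => Finset.sum_congr rfl fun h _ =>
    Finset.sum_congr rfl fun h' _ => ?_
  simp only [star_mul', star_pow, Complex.star_def, Complex.conj_ofReal]
  ring

theorem effective_piTensor {n : ℕ} {H K : Type} [Fintype H] [Fintype K] (e : K ≃ (Fin n → H))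
    (C : Fin n → Matrix (Fin 2 × H) (Fin 2 × H) ℂ) (B : Fin n → Matrix H H ℂ) :
    effective ((piTensor C).submatrix (fun (p : Bits n × K) i => (p.1 i, e p.2 i))
        fun p i => (p.1 i, e p.2 i)) ((piTensor B).submatrix e e) =
      piTensor fun i => effective (C i) (B i) := by
  ext y y'
  simp only [effective, Matrix.submatrix_apply, piTensor]
  rw [e.sum_comp fun h => ∑ h', (∏ i, C i (y i, h i) (y' i, e h' i)) *
    ∏ i, B i (h i) (e h' i)]
  simp_rw [fun h : Fin n → H => e.sum_comp fun h' => (∏ i, C i (y i, h i) (y' i, h' i)) *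
    ∏ i, B i (h i) (h' i)]
  simp only [Fintype.card_congr e, Finset.prod_mul_distrib, Finset.prod_const, Finset.card_univ,
    Fintype.card_fin, Finset.prod_univ_sum, Fintype.piFinset_univ, Fintype.card_fun, Nat.cast_pow,
    inv_pow]

theorem conj_apply_self {κ : Type} [Fintype κ] (V T : Matrix κ κ ℂ) (x : κ) :
    (Vᴴ * T * V) x x = star (fun y => V y x) ⬝ᵥ (T *ᵥ fun y => V y x) := by
  rw [mul_assoc]
  rfl

namespace Relay

variable {t : ℕ} {W : (Fin t → U2) → (Fin t → U2) → U2} {N k : ℕ}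
  (R : Relay (Fin t → U2) (Fin t → U2) W N k) (n : ℕ)

/-- The `n * relayCost N k` EPR pairs are distributed over the `n` relays. Any bijection of the bases
serves, because the maximally entangled state only compares basis labels. -/
def registerEquiv : Bits (n * relayCost N k) ≃ (Fin n → R.H) :=
  Fintype.equivOfCardEq (by
    rw [Fintype.card_fun, Fintype.card_fun, R.card_H, Fintype.card_fin, Fintype.card_fin,
      Fintype.card_fin, ← pow_mul, mul_comm])

/-- Enumeration of Alice's joint outcomes. -/
def holderOutcomes : Fin (Fintype.card (Fin n → R.OH)) ≃ (Fin n → R.OH) :=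
  (Fintype.equivFin _).symm

/-- Enumeration of Bob's joint outcomes. -/
def helperOutcomes : Fin (Fintype.card (Fin n → R.OO)) ≃ (Fin n → R.OO) :=
  (Fintype.equivFin _).symm

/-- Alice measures every challenge qubit as the holder of its relay. -/
def aliceMeasurement (u : Fin t → U2) :
    Measurement (Fintype.card (Fin n → R.OH)) (Bits n × Bits (n * relayCost N k)) where
  effect a := (piTensor fun i => R.holder u (R.holderOutcomes n a i)).submatrix
    (fun p i => (p.1 i, R.registerEquiv n p.2 i)) fun p i => (p.1 i, R.registerEquiv n p.2 i)
  posSemidef _ := (piTensor_posSemidef fun _ => R.holder_posSemidef _ _).submatrix _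
  sum_eq_one := by
    have h := sum_piTensor (fun (_ : Fin n) (o : R.OH) => R.holder u o)
    simp only [R.sum_holder, piTensor_one] at h
    rw [← (R.holderOutcomes n).sum_comp] at h
    ext p q
    have := congrArg (fun A : Matrix (Fin n → Fin 2 × R.H) (Fin n → Fin 2 × R.H) ℂ =>
      A (fun i => (p.1 i, R.registerEquiv n p.2 i))
        fun i => (q.1 i, R.registerEquiv n q.2 i)) h
    simp only [Matrix.sum_apply, Matrix.submatrix_apply, Matrix.one_apply, funext_iff,
      Prod.ext_iff, forall_and] at this ⊢
    rw [this]
    simp only [← funext_iff, (R.registerEquiv n).injective.eq_iff]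

/-- Bob is the helper of every relay. -/
def bobMeasurement (v : Fin t → U2) :
    Measurement (Fintype.card (Fin n → R.OO)) (Bits (n * relayCost N k)) where
  effect b := (piTensor fun i => R.helper v (R.helperOutcomes n b i)).submatrix
    (R.registerEquiv n) (R.registerEquiv n)
  posSemidef _ := (piTensor_posSemidef fun _ => R.helper_posSemidef _ _).submatrix _
  sum_eq_one := by
    have h := sum_piTensor (fun (_ : Fin n) (o : R.OO) => R.helper v o)
    simp only [R.sum_helper, piTensor_one] at h
    rw [← (R.helperOutcomes n).sum_comp] at h
    rw [← Matrix.submatrix_one_equiv (R.registerEquiv n), ← h]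
    ext p q
    simp only [Matrix.sum_apply, Matrix.submatrix_apply]

/-- The attack that runs an independent copy of the relay `R` on each challenge qubit. -/
def attack : Attack n t (n * relayCost N k) where
  kA := Fintype.card (Fin n → R.OH)
  kB := Fintype.card (Fin n → R.OO)
  alice := R.aliceMeasurement n
  bob := R.bobMeasurement n
  answerA _ _ a b i := some (R.guess (R.holderOutcomes n a i) (R.helperOutcomes n b i))
  answerB _ _ a b i := some (R.guess (R.holderOutcomes n a i) (R.helperOutcomes n b i))
  measurable_alice a p q := by
    simp only [aliceMeasurement, Matrix.submatrix_apply, piTensor]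
    exact Finset.measurable_prod _ fun _ _ => R.measurable_holder _ _ _
  measurable_bob b p q := by
    simp only [bobMeasurement, Matrix.submatrix_apply, piTensor]
    exact Finset.measurable_prod _ fun _ _ => R.measurable_helper _ _ _
  measurable_answerA _ _ _ := MeasurableSet.const _
  measurable_answerB _ _ _ := MeasurableSet.const _

/-- The probability of the outcomes `p` of a single relay when the encoded bit is `z`. -/
def outcomeWeight (u v : Fin t → U2) (z : Fin 2) (p : R.OH × R.OO) : ℝ :=
  (((W u v : Matrix (Fin 2) (Fin 2) ℂ)ᴴ * effective (R.holder u p.1) (R.helper v p.2) *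
    (W u v : Matrix (Fin 2) (Fin 2) ℂ)) z z).re

theorem conj_effective_diag (u v : Fin t → U2) (z : Fin 2) (p : R.OH × R.OO) :
    0 ≤ ((W u v : Matrix (Fin 2) (Fin 2) ℂ)ᴴ * effective (R.holder u p.1) (R.helper v p.2) *
      (W u v : Matrix (Fin 2) (Fin 2) ℂ)) z z :=
  ((R.effective_posSemidef u v p).conjTranspose_mul_mul_same _).diag_nonneg

theorem outcomeWeight_nonneg (u v : Fin t → U2) (z : Fin 2) (p : R.OH × R.OO) :
    0 ≤ R.outcomeWeight u v z p :=
  (Complex.le_def.mp (R.conj_effective_diag u v z p)).1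

theorem sum_outcomeWeight (u v : Fin t → U2) (z : Fin 2) :
    ∑ p, R.outcomeWeight u v z p = 1 := by
  simp only [outcomeWeight]
  rw [← Complex.re_sum, ← Matrix.sum_apply, ← Finset.sum_mul, ← Finset.mul_sum,
    R.sum_effective, mul_one, U2_conjTranspose_mul]
  simp

theorem sum_outcomeWeight_error_le (u v : Fin t → U2) (z : Fin 2) :
    ∑ p, (if R.guess p.1 p.2 ≠ z then R.outcomeWeight u v z p else 0) ≤
      (k : ℝ) ^ 2 * (6 / N) := by
  obtain ⟨z', hz'⟩ : ∃ z' : Fin 2, ∀ b : Fin 2, b ≠ z ↔ b = z' := by revert z; decide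
  have h := (Complex.le_def.mp (R.error_le u v z' z ((hz' z').mpr rfl))).1
  rw [Complex.ofReal_re, Finset.mul_sum, Finset.sum_mul, Matrix.sum_apply, Complex.re_sum] at h
  refine le_trans (le_of_eq (Finset.sum_congr rfl fun p _ => ?_)) h
  simp only [hz']
  split_ifs
  · rfl
  · simp

theorem outcomeProb_attack (u v : Fin t → U2) (x : Bits n)
    (a : Fin (Fintype.card (Fin n → R.OH))) (b : Fin (Fintype.card (Fin n → R.OO))) :
    outcomeProb (R.attack n) (challengeState (W u v) x) u v a b =
      ∏ i, R.outcomeWeight u v (x i) (R.holderOutcomes n a i, R.helperOutcomes n b i) := by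
  have hψ : challengeState (W u v) x = fun y =>
      piTensor (fun _ : Fin n => (W u v : Matrix (Fin 2) (Fin 2) ℂ)) y x := rfl
  have h : star (challengeState (W u v) x) ⬝ᵥ (effective ((R.aliceMeasurement n u).effect a)
      ((R.bobMeasurement n v).effect b) *ᵥ challengeState (W u v) x) =
      ((∏ i, R.outcomeWeight u v (x i) (R.holderOutcomes n a i, R.helperOutcomes n b i) : ℝ) :
        ℂ) := by
    simp only [aliceMeasurement, bobMeasurement]
    rw [effective_piTensor, hψ, ← conj_apply_self, piTensor_conjTranspose, piTensor_mul,
      piTensor_mul, piTensor, Complex.ofReal_prod]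
    refine Finset.prod_congr rfl fun i _ => ?_
    exact Complex.eq_re_of_ofReal_le
      (R.conj_effective_diag u v (x i) (R.holderOutcomes n a i, R.helperOutcomes n b i))
  exact (congrArg Complex.re ((star_jointState_dotProduct _ _ _).trans h)).trans
    (Complex.ofReal_re _)

theorem winProbGiven_attack (η : ℝ) (x : Bits n) (d : Draw t) (hd : W d.2.1 (fullV d) = d.1) :
    winProbGiven (R.attack n) η 0 x d = ∑ f : Fin n → R.OH × R.OO,
      if ((Finset.univ.filter fun i => R.guess (f i).1 (f i).2 ≠ x i).card : ℝ) ≤ η * n then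
        ∏ i, R.outcomeWeight d.2.1 (fullV d) (x i) (f i) else 0 := by
  classical
  rw [← (Equiv.arrowProdEquivProdArrow (Fin n) (fun _ => R.OH) fun _ => R.OO).symm.sum_comp,
    Fintype.sum_prod_type, ← (R.holderOutcomes n).sum_comp, winProbGiven]
  refine Finset.sum_congr rfl fun a _ => ?_
  rw [← (R.helperOutcomes n).sum_comp]
  refine Finset.sum_congr rfl fun b _ => ?_
  refine if_congr ?_ ?_ rfl
  · simp [Accepts, attack, errors, losses]
  · rw [← hd]
    exact R.outcomeProb_attack n _ _ x a b

end Relay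

/-! ### Averaging over the unitaries -/

instance : SecondCountableTopology U2 :=
  haveI : SecondCountableTopology (Matrix (Fin 2) (Fin 2) ℂ) :=
    inferInstanceAs (SecondCountableTopology (Fin 2 → Fin 2 → ℂ))
  inferInstanceAs (SecondCountableTopology
    (Matrix.unitaryGroup (Fin 2) ℂ : Set (Matrix (Fin 2) (Fin 2) ℂ)))

instance : IsProbabilityMeasure haarU2 := ⟨by
  simpa [haarU2] using Measure.haarMeasure_self (G := U2) (K₀ := ⊤)⟩

instance (t : ℕ) : IsProbabilityMeasure (drawMeasure t) := by
  unfold drawMeasure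
  infer_instance

theorem measurable_fullV {t : ℕ} (i : Fin t) : Measurable fun d : Draw t => fullV d i := by
  unfold fullV
  split_ifs with h
  · exact (measurable_pi_apply _).comp (measurable_snd.comp measurable_snd)
  · have hu : ∀ j, Measurable fun d : Draw t => d.2.1 j := fun j =>
      (measurable_pi_apply j).comp (measurable_fst.comp measurable_snd)
    have hv : ∀ j, Measurable fun d : Draw t => d.2.2 j := fun j =>
      (measurable_pi_apply j).comp (measurable_snd.comp measurable_snd)
    have hprod : Measurable fun d : Draw t => (List.ofFn fun j : Fin (t - 1) =>
        d.2.1 (Fin.castLE (Nat.sub_le t 1) j) * d.2.2 j).prod := by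
      have := List.measurable_fun_prod ((List.finRange (t - 1)).map fun j (d : Draw t) =>
        d.2.1 (Fin.castLE (Nat.sub_le t 1) j) * d.2.2 j) (by
          simp only [List.mem_map, forall_exists_index, and_imp]
          rintro _ j _ rfl
          exact (hu _).mul (hv j))
      simpa [List.ofFn_eq_map, Function.comp_def] using this
    exact ((hprod.mul (hu i)).inv).mul measurable_fst

/-- The unitaries `v₁, …, v_t` are such that `u₁ v₁ ⋯ u_t v_t = U`; the last factor is separated, as in
`Relay.nonempty_of_list`. -/
theorem prod_fullV {t : ℕ} (ht : t - 1 < t) (d : Draw t) :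
    (((List.finRange (t - 1)).map (Fin.castLE (Nat.sub_le t 1))).map
      fun j => d.2.1 j * fullV d j).prod * (d.2.1 ⟨t - 1, ht⟩ * fullV d ⟨t - 1, ht⟩) = d.1 := by
  have h1 : ∀ j : Fin (t - 1), fullV d (Fin.castLE (Nat.sub_le t 1) j) = d.2.2 j := fun j => by
    simp [fullV, j.2]
  have h2 : fullV d ⟨t - 1, ht⟩ = ((List.ofFn fun j : Fin (t - 1) =>
      d.2.1 (Fin.castLE (Nat.sub_le t 1) j) * d.2.2 j).prod * d.2.1 ⟨t - 1, ht⟩)⁻¹ * d.1 := by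
    simp [fullV]
  rw [h2, List.map_map, List.ofFn_eq_map]
  simp only [Function.comp_def, h1]
  group

theorem measurable_outcomeProb {n t M : ℕ} (S : Attack n t M) (x : Bits n) (a : Fin S.kA)
    (b : Fin S.kB) : Measurable fun d : Draw t =>
      outcomeProb S (challengeState d.1 x) d.2.1 (fullV d) a b := by
  have hA : ∀ p q, Measurable fun d : Draw t => (S.alice d.2.1).effect a p q :=
    fun p q => (S.measurable_alice a p q).comp (measurable_fst.comp measurable_snd)
  have hB : ∀ p q, Measurable fun d : Draw t => (S.bob (fullV d)).effect b p q :=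
    fun p q => (S.measurable_bob b p q).comp (measurable_pi_lambda _ measurable_fullV)
  have hU : ∀ i j, Measurable fun d : Draw t => (d.1 : Matrix (Fin 2) (Fin 2) ℂ) i j :=
    fun i j => (measurable_U2_entry i j).comp measurable_fst
  have hJ : ∀ p, Measurable fun d : Draw t => jointState M (challengeState d.1 x) p := fun p =>
    (Finset.measurable_prod _ fun i _ => hU _ _).mul_const _
  refine Complex.measurable_re.comp ?_
  simp only [dotProduct, Matrix.mulVec, Matrix.kroneckerMap_apply, Pi.star_apply]
  exact Finset.measurable_sum _ fun p _ => (continuous_star.measurable.comp (hJ p)).mul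
    (Finset.measurable_sum _ fun q _ => ((hA _ _).mul (hB _ _)).mul (hJ q))

theorem measurable_winProbGiven_attack {t N k : ℕ} {W : (Fin t → U2) → (Fin t → U2) → U2}
    (R : Relay (Fin t → U2) (Fin t → U2) W N k) (n : ℕ) (η : ℝ) (x : Bits n) :
    Measurable fun d => winProbGiven (R.attack n) η 0 x d :=
  Finset.measurable_sum _ fun a _ => Finset.measurable_sum _ fun b _ =>
    Measurable.ite (by simp only [Relay.attack]; exact MeasurableSet.const _)
      (measurable_outcomeProb (R.attack n) x a b)
      measurable_const

theorem le_winProb_attack {t N k : ℕ} {W : (Fin t → U2) → (Fin t → U2) → U2}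
    (R : Relay (Fin t → U2) (Fin t → U2) W N k) (n : ℕ) {η : ℝ} (hη : 0 < η) (hη1 : η ≤ 1)
    (hW : ∀ d : Draw t, W d.2.1 (fullV d) = d.1) (hk : (k : ℝ) ^ 2 * (6 / N) ≤ η ^ 2) :
    1 - min η (Real.exp (-2 * n * (η - η ^ 2) ^ 2)) ≤ winProb (R.attack n) η 0 := by
  have hlow : ∀ d x, 1 - min η (Real.exp (-2 * n * (η - η ^ 2) ^ 2)) ≤
      winProbGiven (R.attack n) η 0 x d := fun d x => by
    rw [R.winProbGiven_attack n η x d (hW d)]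
    exact one_sub_min_le_sum (p := fun i o => R.outcomeWeight d.2.1 (fullV d) (x i) o)
      (bad := fun i o => R.guess o.1 o.2 ≠ x i) (fun i o => R.outcomeWeight_nonneg _ _ _ _)
      (fun i => R.sum_outcomeWeight _ _ _) hη hη1
      fun i => (R.sum_outcomeWeight_error_le _ _ _).trans hk
  have hpos : ∀ d x, 0 ≤ winProbGiven (R.attack n) η 0 x d := fun d x => by
    rw [R.winProbGiven_attack n η x d (hW d)]
    refine Finset.sum_nonneg fun f _ => ?_
    split_ifs
    · exact Finset.prod_nonneg fun i _ => R.outcomeWeight_nonneg _ _ _ _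
    · exact le_rfl
  have hup : ∀ d x, winProbGiven (R.attack n) η 0 x d ≤ 1 := fun d x => by
    rw [R.winProbGiven_attack n η x d (hW d)]
    refine (Finset.sum_le_sum fun f _ => ?_).trans_eq
      (sum_prod_eq_one fun i => R.sum_outcomeWeight d.2.1 (fullV d) (x i))
    split_ifs
    · exact le_rfl
    · exact Finset.prod_nonneg fun i _ => R.outcomeWeight_nonneg _ _ _ _
  have hcard : ∀ c : ℝ, (∑ _x : Bits n, c) / 2 ^ n = c := fun c => by
    simp [Finset.sum_const, mul_div_cancel_left₀]
  have hint : Integrable (fun d => (∑ x : Bits n, winProbGiven (R.attack n) η 0 x d) / 2 ^ n)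
      (drawMeasure t) := by
    refine Integrable.of_mem_Icc 0 1 ?_ (Filter.Eventually.of_forall fun d => ⟨?_, ?_⟩)
    · exact ((Finset.measurable_sum _ fun x _ =>
        measurable_winProbGiven_attack R n η x).div_const _).aemeasurable
    · exact div_nonneg (Finset.sum_nonneg fun x _ => hpos d x) (by positivity)
    · rw [← hcard 1]
      gcongr with x
      exact hup d x
  have h := integral_mono (integrable_const (μ := drawMeasure t)
    (1 - min η (Real.exp (-2 * n * (η - η ^ 2) ^ 2)))) hint fun d => by
      simp only
      rw [← hcard (1 - _)]
      gcongr with x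
      exact hlow d x
  rw [integral_const, probReal_univ, one_smul] at h
  exact h

/-- The number of ports for which `2 * t - 1` layers err with probability at most `η ^ 2` fits into the
bound. -/
theorem ceil_ports_le {t : ℕ} (ht : 1 ≤ t) {η : ℝ} (hη : 0 < η) (hη1 : η ≤ 1) :
    (⌈6 * (2 * (t : ℝ) - 1) ^ 2 / η ^ 2⌉₊ : ℝ) ≤ (2 * t / η) ^ 4 := by
  have ht' : (1 : ℝ) ≤ t := by exact_mod_cast ht
  have h1 : (2 * (t : ℝ) - 1) ^ 2 ≤ (t : ℝ) ^ 4 := by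
    have : (2 * (t : ℝ) - 1) ≤ t ^ 2 := by nlinarith [sq_nonneg ((t : ℝ) - 1)]
    calc (2 * (t : ℝ) - 1) ^ 2 ≤ ((t : ℝ) ^ 2) ^ 2 := by gcongr; linarith
      _ = (t : ℝ) ^ 4 := by ring
  have h2 : η ^ 4 ≤ η ^ 2 := pow_le_pow_of_le_one hη.le hη1 (by norm_num)
  have h3 : (1 : ℝ) ≤ t ^ 4 / η ^ 4 := by
    rw [one_le_div (by positivity)]
    exact (pow_le_one₀ hη.le hη1).trans (one_le_pow₀ ht')
  calc (⌈6 * (2 * (t : ℝ) - 1) ^ 2 / η ^ 2⌉₊ : ℝ) ≤ 6 * (2 * (t : ℝ) - 1) ^ 2 / η ^ 2 + 1 :=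
        (Nat.ceil_lt_add_one (by positivity)).le
    _ ≤ 6 * t ^ 4 / η ^ 4 + t ^ 4 / η ^ 4 := by gcongr
    _ ≤ 16 * (t ^ 4 / η ^ 4) := by
        rw [mul_div_assoc]
        linarith
    _ = (2 * t / η) ^ 4 := by ring

end InterleavedProduct

end

theorem theorem4 :
    ∃ c : ℝ, 0 < c ∧ c < 3 ∧
      ∀ (n t : ℕ), 1 ≤ t → ∀ ηerr : ℝ, 0 < ηerr → ηerr ≤ 1 →
        ∃ (M : ℕ) (S : InterleavedProduct.Attack n t M),
          (M : ℝ) ≤ (2 : ℝ) ^ (8 * (t : ℝ) * (Real.logb 2 (2 * t / ηerr)) ^ c) * n ∧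
          1 - min ηerr (Real.exp (-2 * n * (ηerr - ηerr ^ 2) ^ 2)) ≤
            InterleavedProduct.winProb S ηerr 0 := by
  open InterleavedProduct in
  refine ⟨1, one_pos, by norm_num, fun n t ht η hη hη1 => ?_⟩
  have ht' : (1 : ℝ) ≤ t := by exact_mod_cast ht
  set N : ℕ := ⌈6 * (2 * (t : ℝ) - 1) ^ 2 / η ^ 2⌉₊ with hN
  have hNlow : 6 * (2 * (t : ℝ) - 1) ^ 2 / η ^ 2 ≤ N := Nat.le_ceil _
  have hN6 : (6 : ℝ) ≤ N := by
    refine le_trans ?_ hNlow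
    rw [le_div_iff₀ (by positivity)]
    have : η ^ 2 ≤ 1 := pow_le_one₀ hη.le hη1
    nlinarith
  have hN2 : 2 ≤ N := by
    have : (2 : ℝ) ≤ N := by linarith
    exact_mod_cast this
  have : NeZero N := ⟨by omega⟩
  obtain ⟨R⟩ := Relay.nonempty_of_list N (⟨t - 1, by omega⟩ : Fin t)
    ((List.finRange (t - 1)).map (Fin.castLE (Nat.sub_le t 1)))
  set k := 2 * ((List.finRange (t - 1)).map (Fin.castLE (Nat.sub_le t 1))).length + 1 with hk
  have hk1 : k + 1 = 2 * t := by
    rw [hk, List.length_map, List.length_finRange]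
    omega
  have hk2 : (k : ℝ) = 2 * t - 1 := by
    have : ((k + 1 : ℕ) : ℝ) = ((2 * t : ℕ) : ℝ) := by rw [hk1]
    push_cast at this
    linarith
  refine ⟨_, R.attack n, ?_, le_winProb_attack R n hη hη1 (prod_fullV _) ?_⟩
  · have hx : 0 < 2 * (t : ℝ) / η := by positivity
    have hcost : (relayCost N k : ℝ) ≤ (N : ℝ) ^ (2 * t) := by
      rw [← hk1]
      exact_mod_cast (Nat.le_add_right _ 2).trans (relayCost_add_two_le hN2 k)
    rw [Real.rpow_one, mul_comm (8 * (t : ℝ)), Real.rpow_mul (by norm_num),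
      Real.rpow_logb (by norm_num) (by norm_num) hx]
    have h8 : (2 * (t : ℝ) / η) ^ (8 * (t : ℝ)) = ((2 * (t : ℝ) / η) ^ 4) ^ (2 * t) := by
      rw [← pow_mul, ← Real.rpow_natCast]
      congr 1
      push_cast
      ring
    rw [h8]
    push_cast
    rw [mul_comm]
    gcongr
    exact hcost.trans (pow_le_pow_left₀ (Nat.cast_nonneg _) (ceil_ports_le ht hη hη1) _)
  · have hN0 : (0 : ℝ) < N := by linarith
    rw [hk2, mul_div_assoc', div_le_iff₀ hN0]
    rw [div_le_iff₀ (by positivity)] at hNlow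
    linarith
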